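/- Let $n\ge 2$ and let $t_1,\dots,t_n\ge 3$ be integers. The generalized Brussels sprouts game $BS_n(\mathcal P_4:t_1,\dots,t_n)$ is played on the sphere (equivalently, in the plane). It starts with $n$ spots, the $i$-th spot having $t_i$ open tips. A move joins two distinct open tips by a curve that crosses neither itself nor anything drawn before, and then draws a crossbar on this curve; the crossbar provides two new open tips, one on each side of the curve, and the two joined tips are used up. The graph whose vertices are the spots and the points where a crossbar meets its curve, and whose edges are the pieces of the curves between consecutive such vertices, must at all times belong to the family $\mathcal P_4$ of planar graphs of girth at least $4$ (in particular it has no loops, no parallel edges and no triangles). The game ends when no move is possible. Then every play of $BS_n(\mathcal P_4:t_1,\dots,t_n)$ ends: no sequence of moves is longer than $(n-2)+\sum_{i=1}^n t_i$. Moreover, if a play ends after exactly $x$ moves, then $$n+4\;\le\; x\;\le\;(n-2)+\sum_{i=1}^n t_i .$$ -/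

import Mathlib

/-!
Generalized Brussels sprouts on the sphere (equivalently, in the plane).

A position is a plane drawing, recorded up to homeomorphism by its half-edges: the cyclic order of
the half-edges around each vertex, the pairing of half-edges into edges (an unpaired half-edge is an
open tip), and which sides of half-edges lie in the same region of the drawing.  The drawing may be
disconnected, so a region may have several boundary components.
-/

namespace BrusselsSprout

/-- The vertices after `k` moves: the `n` initial spots, and for each move the point where its
crossbar meets its curve. -/
abbrev Vertex (n k : ℕ) : Type := Fin n ⊕ Fin k

/-- The half-edges after `k` moves: `t i` of them at the spot `i`, and four at each crossbar vertex.
At a crossbar vertex, the half-edges `0` and `2` are the two halves of the curve and `1` and `3` are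
the two arms of the crossbar. -/
abbrev HalfEdge {n : ℕ} (t : Fin n → ℕ) (k : ℕ) : Type := (Σ i : Fin n, Fin (t i)) ⊕ (Fin k × Fin 4)

variable {n : ℕ} {t : Fin n → ℕ} {k : ℕ}

/-- The vertex from which a half-edge emanates. -/
def HalfEdge.vertex : HalfEdge t k → Vertex n k
  | .inl d => .inl d.1
  | .inr d => .inr d.1

/-- The next half-edge, in clockwise order, around the same vertex. -/
def HalfEdge.rot : HalfEdge t k → HalfEdge t k
  | .inl d => .inl ⟨d.1, finRotate (t d.1) d.2⟩
  | .inr d => .inr (d.1, d.2 + 1)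

/-- A half-edge of the current drawing, seen in the drawing after one more move. -/
def HalfEdge.old (d : HalfEdge t k) : HalfEdge t (k + 1) :=
  Sum.map id (Prod.map Fin.castSucc id) d

/-- The four half-edges, in clockwise order, at the vertex added by the last move. -/
def HalfEdge.new (s : Fin 4) : HalfEdge t (k + 1) :=
  .inr (Fin.last k, s)

/-- A drawing on the sphere with half-edges `HalfEdge t k`.

`mate d` is the other half of the edge containing `d`, and is `d` itself when `d` is an open tip.

`region d e` means that the same region (connected component of the complement of the drawing) lies
to the left of `d` and to the left of `e`, both directed away from their vertices.  Following `d`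
outwards with this region on the left one arrives along `mate d` (for an open tip: one turns round
the free end and comes back along `d`), and goes on along the next half-edge in clockwise order. -/
structure Drawing (t : Fin n → ℕ) (k : ℕ) where
  mate : HalfEdge t k → HalfEdge t k
  mate_mate : ∀ d, mate (mate d) = d
  region : Setoid (HalfEdge t k)
  region_rot_mate : ∀ d, region d (mate d).rot

namespace Drawing

/-- `d` is an open tip. -/
def IsTip (D : Drawing t k) (d : HalfEdge t k) : Prop := D.mate d = d

/-- One step along the boundary of the region to the left of `d`. -/
def next (D : Drawing t k) (d : HalfEdge t k) : HalfEdge t k := (D.mate d).rot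

/-- The left sides of `d` and `e` are on the same boundary component of the same region: the
boundary walk that starts with `d` passes through `e`. -/
def SameBoundary (D : Drawing t k) (d e : HalfEdge t k) : Prop := ∃ m : ℕ, D.next^[m] d = e

/-- The (multi)graph that is drawn: its edges are the pairs of mated half-edges; open tips do not
count. -/
def graph (D : Drawing t k) : Graph (Vertex n k) (Sym2 (HalfEdge t k)) where
  vertexSet := Set.univ
  IsLink e x y := ∃ d, ¬ D.IsTip d ∧ e = s(d, D.mate d) ∧ d.vertex = x ∧ (D.mate d).vertex = y
  isLink_symm := by
    intro e _
    refine ⟨?_⟩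
    rintro x y ⟨d, hd, rfl, rfl, rfl⟩
    refine ⟨D.mate d, ?_, ?_, rfl, ?_⟩
    · intro h
      exact hd ((D.mate_mate d).symm.trans h).symm
    · rw [D.mate_mate, Sym2.eq_swap]
    · rw [D.mate_mate]
  eq_or_eq_of_isLink_of_isLink := by
    rintro e x y v w ⟨d, -, rfl, rfl, rfl⟩ ⟨d', -, h, rfl, rfl⟩
    rcases Sym2.eq_iff.1 h with ⟨h₁, -⟩ | ⟨h₁, -⟩
    · exact Or.inl (by rw [h₁])
    · exact Or.inr (by rw [h₁])
  left_mem_of_isLink := fun _ _ _ _ => Set.mem_univ _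

/-- The initial position: all half-edges are open tips, and the complement of the `n` spots is a
single region. -/
def start (t : Fin n → ℕ) : Drawing t 0 where
  mate d := d
  mate_mate _ := rfl
  region := ⊤
  region_rot_mate _ := trivial

/-- `D'` arises from `D` by joining the open tips `a` and `b` by a curve inside a region of `D`, and
drawing a crossbar on it.

The first half of the curve is `a` and `new 0`, the second half is `b` and `new 2`, and `new 1` and
`new 3` are the open tips on its two sides.  All regions of `D` other than the one that contains the
curve persist.  If `a` and `b` are on the same boundary component of that region, then the curve
cuts it into two regions, one on either side of the curve, and each of the other boundary components
may be on either side; otherwise the curve does not separate the region. -/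
structure IsMove (D : Drawing t k) (a b : HalfEdge t k) (D' : Drawing t (k + 1)) : Prop where
  isTip_left : D.IsTip a
  isTip_right : D.IsTip b
  ne : a ≠ b
  region : D.region a b
  mate_left : D'.mate a.old = .new 0
  mate_right : D'.mate b.old = .new 2
  isTip_new_one : D'.IsTip (.new 1)
  isTip_new_three : D'.IsTip (.new 3)
  mate_old : ∀ d, d ≠ a → d ≠ b → D'.mate d.old = (D.mate d).old
  region_of_region : ∀ d e, D'.region d.old e.old → D.region d e
  region_persists : ∀ d e, ¬ D.region a d → D.region d e → D'.region d.old e.old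
  region_split : ∀ d, D.region a d → D'.region (.new 1) d.old ∨ D'.region (.new 3) d.old
  separates_iff : ¬ D'.region (.new 1) (.new 3) ↔ D.SameBoundary a b

end Drawing

/-- The positions that can be reached after `k` moves in the game, played on the sphere, for a family
`F` of graphs, from spots with `t i` open tips: after each move the graph drawn must belong to `F`. -/
inductive Reachable (F : ∀ {α β : Type}, Graph α β → Prop) (t : Fin n → ℕ) :
    ∀ k : ℕ, Drawing t k → Prop
  | start : Reachable F t 0 (Drawing.start t)
  | move {k : ℕ} {D : Drawing t k} {D' : Drawing t (k + 1)} {a b : HalfEdge t k} :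
      Reachable F t k D → D.IsMove a b D' → F D'.graph → Reachable F t (k + 1) D'

/-- The game is over: there is no valid move. -/
def Ended (F : ∀ {α β : Type}, Graph α β → Prop) (D : Drawing t k) : Prop :=
  ∀ (a b : HalfEdge t k) (D' : Drawing t (k + 1)), D.IsMove a b D' → ¬ F D'.graph

/-- Girth at least four: no loops, no parallel edges, no triangles.  A graph with a drawing on the
sphere is planar, so the graphs of drawings with this property are exactly the triangle-free planar
graphs that occur in the game. -/
def GirthAtLeastFour {α β : Type} (G : Graph α β) : Prop :=
  G.Simple ∧ 4 ≤ G.toSimpleGraph.egirth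

end BrusselsSprout

/-! Call a move separating if its two tips lie on the same boundary component of their region, and
merging otherwise; let `S` and `M` count the two kinds. `Tally` records an Euler count: at least `1
+ S` regions, at least `n - M` components, and at most `n + S - M` boundary components, each of
which carries an open tip. Regions and components are counted by the dimensions of the spaces of
functions constant on them. The number of open tips never grows. As every region has a boundary
component, `M ≤ n - 1` and `S + 1 ≤ ∑ i, t i`, which is the upper bound (`Tally.le`).

A drawing is combinatorial data, so planarity has to be extracted from this count.
`Tally.exists_compFun_ne` shows that a merging move always joins different components of the
drawing, and `IsMove.bridgeProperty` derives that an edge with the same boundary component on both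
sides is a bridge.

In a final position two open tips in one region belong to equal or adjacent vertices, since
otherwise a move between them would be legal. Hence every region has a single boundary component,
the drawing is connected and `M ≥ n - 1`. If there are at least six boundary components, then `6 + M
≤ n + S`, so `S + M ≥ 6 + 2 * M - n ≥ n + 4`.

The six boundary components come from `Closed.exists_six`. Suppose a boundary passes two open tips
of crossbars (peaks). Their vertices are equal or adjacent, which forces a bridge; cutting it leaves
a smaller set of half-edges with the same properties (`Closed.shrinks_of_peaks`). In a set that
cannot shrink, each boundary has at most one peak. Every walk leaving a spot along an edge climbs to
a peak, so distinct edge ends at spots lie on distinct boundaries. It remains to find six such ends: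
three spots with two each, or two spots with three each. -/

namespace BrusselsSprout

variable {n : ℕ} {t : Fin n → ℕ} {k : ℕ}

/-! ### Half-edges of successive drawings and rotation about a vertex -/

namespace HalfEdge

/-- Every half-edge after one more move is an old one or one of the four new ones. -/
def decode (x : HalfEdge t (k + 1)) : HalfEdge t k ⊕ Fin 4 :=
  match x with
  | .inl d => .inl (.inl d)
  | .inr (j, s) => Fin.lastCases (motive := fun _ => HalfEdge t k ⊕ Fin 4) (.inr s)
      (fun i => .inl (.inr (i, s))) j

@[simp] theorem decode_old (d : HalfEdge t k) : decode d.old = .inl d := by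
  rcases d with d | ⟨j, s⟩ <;> simp [decode, old]

@[simp] theorem decode_new (s : Fin 4) : decode (new s : HalfEdge t (k + 1)) = .inr s := by
  simp [decode, new]

theorem old_or_new (x : HalfEdge t (k + 1)) :
    (∃ d : HalfEdge t k, x = d.old) ∨ ∃ s, x = new s := by
  rcases x with d | ⟨j, s⟩
  · exact .inl ⟨.inl d, rfl⟩
  · induction j using Fin.lastCases with
    | last => exact .inr ⟨s, rfl⟩
    | cast i => exact .inl ⟨.inr (i, s), rfl⟩

@[elab_as_elim]
theorem cases_old_new {P : HalfEdge t (k + 1) → Prop} (x : HalfEdge t (k + 1))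
    (old : ∀ d : HalfEdge t k, P d.old) (new : ∀ s, P (new s)) : P x := by
  rcases old_or_new x with ⟨d, rfl⟩ | ⟨s, rfl⟩
  exacts [old d, new s]

theorem old_injective : Function.Injective (old : HalfEdge t k → HalfEdge t (k + 1)) := by
  intro x y h
  simpa using congrArg decode h

@[simp] theorem old_inj {x y : HalfEdge t k} : x.old = y.old ↔ x = y := old_injective.eq_iff

@[simp] theorem new_inj {s s' : Fin 4} :
    (new s : HalfEdge t (k + 1)) = new s' ↔ s = s' := by simp [new]

@[simp] theorem old_ne_new (x : HalfEdge t k) (s : Fin 4) : x.old ≠ new s := by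
  intro h
  simpa using congrArg decode h

@[simp] theorem new_ne_old (x : HalfEdge t k) (s : Fin 4) : new s ≠ x.old := (old_ne_new x s).symm

theorem rot_old (x : HalfEdge t k) : x.old.rot = x.rot.old := by
  rcases x with d | ⟨j, s⟩ <;> rfl

theorem rot_new (s : Fin 4) : (new s : HalfEdge t (k + 1)).rot = new (s + 1) := rfl

theorem rot_injective : Function.Injective (rot : HalfEdge t k → HalfEdge t k) := by
  rintro (⟨i, x⟩ | ⟨j, s⟩) (⟨i', x'⟩ | ⟨j', s'⟩) h
  · simp only [rot, Sum.inl.injEq, Sigma.mk.injEq] at h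
    obtain ⟨rfl, h⟩ := h
    simpa using h
  · simp [rot] at h
  · simp [rot] at h
  · simpa [rot] using h

@[simp] theorem vertex_rot (x : HalfEdge t k) : x.rot.vertex = x.vertex := by
  rcases x with d | ⟨j, s⟩ <;> rfl

@[simp] theorem vertex_old (x : HalfEdge t k) :
    x.old.vertex = Sum.map id Fin.castSucc x.vertex := by
  rcases x with d | ⟨j, s⟩ <;> rfl

@[simp] theorem vertex_new (s : Fin 4) :
    (new s : HalfEdge t (k + 1)).vertex = .inr (Fin.last k) := rfl

theorem vertex_old_inj {x y : HalfEdge t k} :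
    x.old.vertex = y.old.vertex ↔ x.vertex = y.vertex := by
  simp only [vertex_old]
  exact (Function.Injective.sumMap Function.injective_id (Fin.castSucc_injective _)).eq_iff

theorem vertex_old_ne_new (x : HalfEdge t k) (s : Fin 4) :
    x.old.vertex ≠ (new s : HalfEdge t (k + 1)).vertex := by
  rcases x with d | ⟨j, r⟩ <;> intro h
  · cases h
  · exact (Fin.castSucc_lt_last j).ne (Sum.inr.inj h)

open scoped Fin.CommRing in
theorem exists_rot_iterate {x y : HalfEdge t k} (h : x.vertex = y.vertex) :
    ∃ m, rot^[m] x = y := by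
  have key : ∀ {N : ℕ} (p q : Fin N), ∃ m, (finRotate N)^[m] p = q := by
    intro N p q
    rcases N with _ | N
    · exact p.elim0
    · refine ⟨(q - p).val, ?_⟩
      have : ∀ m : ℕ, (finRotate (N + 1))^[m] p = p + (m : Fin (N + 1)) := by
        intro m
        induction m with
        | zero => simp
        | succ m ih => rw [Function.iterate_succ_apply', ih, finRotate_apply]; push_cast; abel
      rw [this, Fin.cast_val_eq_self, add_sub_cancel]
  rcases x with ⟨i, p⟩ | ⟨j, s⟩ <;> rcases y with ⟨i', q⟩ | ⟨j', s'⟩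
  · obtain rfl : i = i' := by simpa [vertex] using h
    obtain ⟨m, hm⟩ := key p q
    refine ⟨m, ?_⟩
    have : ∀ m : ℕ, (rot : HalfEdge t k → _)^[m] (.inl ⟨i, p⟩) = .inl ⟨i, (finRotate (t i))^[m] p⟩ := by
      intro m
      induction m with
      | zero => rfl
      | succ m ih => rw [Function.iterate_succ_apply', ih, Function.iterate_succ_apply']; rfl
    rw [this, hm]
  · simp [vertex] at h
  · simp [vertex] at h
  · obtain rfl : j = j' := by simpa [vertex] using h
    refine ⟨(s' - s).val, ?_⟩
    have : ∀ m : ℕ, (rot : HalfEdge t k → _)^[m] (.inr (j, s)) = .inr (j, s + (m : Fin 4)) := by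
      intro m
      induction m with
      | zero => simp
      | succ m ih => 
        rw [Function.iterate_succ_apply', ih]
        simp only [rot, Nat.cast_succ, add_assoc]
    rw [this, Fin.cast_val_eq_self, add_sub_cancel]

end HalfEdge

/-- Reversibility of reaching under iteration of an injective map of a finite type. -/
theorem exists_iterate_eq_symm {α : Type*} [Finite α] {f : α → α} (hf : Function.Injective f)
    {x y : α} {m : ℕ} (h : f^[m] x = y) : ∃ l, f^[l] y = x := by
  obtain ⟨p, hp, hpx⟩ := hf.mem_periodicPts x
  -- `p` is a period of `x`, so `p * m` steps from `x` lead back to `x`; `m` of them are already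
  -- made.
  refine ⟨p * m - m, ?_⟩
  rw [← h, ← Function.iterate_add_apply, Nat.sub_add_cancel (Nat.le_mul_of_pos_left m hp)]
  exact mul_comm m p ▸ (Function.IsPeriodicPt.const_mul hpx m).eq

/-! ### Boundary walks, adjacency and girth -/

namespace Drawing

variable {D : Drawing t k}

theorem next_injective (D : Drawing t k) : Function.Injective D.next := by
  intro x y h
  have := congrArg D.mate (HalfEdge.rot_injective h)
  simpa [D.mate_mate] using this

theorem SameBoundary.refl (D : Drawing t k) (d : HalfEdge t k) : D.SameBoundary d d := ⟨0, rfl⟩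

theorem SameBoundary.symm {d e : HalfEdge t k} (h : D.SameBoundary d e) : D.SameBoundary e d := by
  obtain ⟨m, hm⟩ := h
  exact exists_iterate_eq_symm D.next_injective hm

theorem SameBoundary.trans {d e f : HalfEdge t k} (h : D.SameBoundary d e)
    (h' : D.SameBoundary e f) : D.SameBoundary d f := by
  obtain ⟨m, rfl⟩ := h
  obtain ⟨l, rfl⟩ := h'
  exact ⟨l + m, Function.iterate_add_apply ..⟩

theorem SameBoundary.next (D : Drawing t k) (d : HalfEdge t k) : D.SameBoundary d (D.next d) :=
  ⟨1, rfl⟩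

theorem SameBoundary.of_setoid {r : HalfEdge t k → HalfEdge t k → Prop} (hr : Equivalence r)
    (h : ∀ d, r d (D.next d)) {d e : HalfEdge t k} (hde : D.SameBoundary d e) : r d e := by
  obtain ⟨m, rfl⟩ := hde
  induction m with
  | zero => exact hr.refl _
  | succ m ih => rw [Function.iterate_succ_apply']; exact hr.trans ih (h _)

theorem SameBoundary.region {d e : HalfEdge t k} (hde : D.SameBoundary d e) : D.region d e :=
  hde.of_setoid D.region.iseqv D.region_rot_mate

theorem IsTip.mate_ne {a d : HalfEdge t k} (ha : D.IsTip a) (h : d ≠ a) : D.mate d ≠ a := by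
  intro h'
  exact h (by rw [← D.mate_mate d, h', ha])

/-- The vertices `x` and `y` are joined by an edge. -/
def Adj (D : Drawing t k) (x y : Vertex n k) : Prop :=
  ∃ d, ¬ D.IsTip d ∧ d.vertex = x ∧ (D.mate d).vertex = y

theorem isTip_mate {d : HalfEdge t k} : D.IsTip (D.mate d) ↔ D.IsTip d := by
  simp only [IsTip, D.mate_mate, eq_comm]

theorem Adj.symm {x y : Vertex n k} (h : D.Adj x y) : D.Adj y x := by
  obtain ⟨d, hd, rfl, rfl⟩ := h
  exact ⟨D.mate d, by rwa [isTip_mate], rfl, by rw [D.mate_mate]⟩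

/-- No loops, no parallel edges and no triangles, in terms of half-edges. -/
structure Sparse (D : Drawing t k) : Prop where
  not_adj_self : ∀ x, ¬ D.Adj x x
  eq_of_vertex : ∀ d e, ¬ D.IsTip d → ¬ D.IsTip e → d.vertex = e.vertex →
    (D.mate d).vertex = (D.mate e).vertex → d = e
  no_triangle : ∀ x y z, D.Adj x y → D.Adj y z → ¬ D.Adj z x

theorem graph_adj {x y : Vertex n k} : D.graph.Adj x y ↔ D.Adj x y := by
  constructor
  · rintro ⟨e, d, hd, -, h⟩
    exact ⟨d, hd, h⟩
  · rintro ⟨d, hd, h⟩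
    exact ⟨_, d, hd, rfl, h⟩

theorem sparse_iff : GirthAtLeastFour D.graph ↔ D.Sparse := by
  constructor
  · rintro ⟨hs, hg⟩
    refine ⟨fun x h => D.graph.not_adj_self x (graph_adj.2 h), ?_, ?_⟩
    · intro d e hd he h h'
      have := hs.eq_of_isLink (e := s(d, D.mate d)) (f := s(e, D.mate e)) ⟨d, hd, rfl, rfl, rfl⟩
        ⟨e, he, rfl, h.symm, h'.symm⟩
      rcases Sym2.eq_iff.1 this with ⟨h₁, -⟩ | ⟨h₁, h₂⟩
      · exact h₁
      -- Here `d` and `e` are the two halves of one edge, so their common vertex would carry a loop.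
      · exfalso
        refine D.graph.not_adj_self d.vertex (graph_adj.2 ⟨d, hd, rfl, ?_⟩)
        rw [h₂, ← h]
    · intro x y z hxy hyz hzx
      have hx : ∀ x : Vertex n k, x ∈ D.graph.vertexSet := fun x => Set.mem_univ x
      have ha : ∀ {x y}, D.Adj x y → D.graph.toSimpleGraph.Adj ⟨x, hx x⟩ ⟨y, hx y⟩ := fun h =>
        (Graph.toSimpleGraph_adj_iff ..).2 (graph_adj.2 h)
      classical
      obtain ⟨u, w, hw, hl⟩ := SimpleGraph.is3Clique_iff_exists_cycle_length_three.1
        ⟨({⟨x, hx x⟩, ⟨y, hx y⟩, ⟨z, hx z⟩} : Finset D.graph.vertexSet), SimpleGraph.is3Clique_triple_iff.2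
          ⟨ha hxy, ha hzx.symm, ha hyz⟩⟩
      have := SimpleGraph.le_egirth.1 hg u w hw
      rw [hl] at this
      exact absurd this (by decide)
  · intro h
    have hL : D.graph.Loopless := ⟨fun e x hx => h.not_adj_self x (graph_adj.1 ⟨e, hx⟩)⟩
    refine ⟨⟨?_⟩, ?_⟩
    · rintro _ _ x y ⟨d, hd, rfl, rfl, rfl⟩ ⟨e, he, rfl, h₁, h₂⟩
      rw [h.eq_of_vertex d e hd he h₁.symm h₂.symm]
    · rw [SimpleGraph.le_egirth]
      intro u w hw
      have h3 := hw.three_le_length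
      rcases h3.eq_or_lt with h3 | h3
      · exfalso
        have ha : ∀ {x y}, D.graph.toSimpleGraph.Adj x y → D.Adj x y := fun h => graph_adj.1 h.2
        match w, h3 with
        | .cons h₁ (.cons h₂ (.cons h₃ .nil)), _ =>
          exact h.no_triangle _ _ _ (ha h₁) (ha h₂) (ha h₃)
      · exact_mod_cast h3

end Drawing

end BrusselsSprout

namespace BrusselsSprout

variable {n : ℕ} {t : Fin n → ℕ} {k : ℕ}

open HalfEdge

/-! ### Effect of a move on boundary walks, regions and adjacency -/

namespace Drawing

variable {D : Drawing t k} {a b : HalfEdge t k} {D' : Drawing t (k + 1)}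

/-- Send an old half-edge to itself, and the new half-edges to `a`. -/
def proj (a : HalfEdge t k) (x : HalfEdge t (k + 1)) : HalfEdge t k :=
  Sum.elim id (fun _ => a) x.decode

@[simp] theorem proj_old (a d : HalfEdge t k) : proj a d.old = d := by simp [proj]

@[simp] theorem proj_new (a : HalfEdge t k) (s : Fin 4) : proj a (new s) = a := by simp [proj]

namespace IsMove

theorem mate_new_zero (h : D.IsMove a b D') : D'.mate (new 0) = a.old := by
  rw [← h.mate_left, D'.mate_mate]

theorem mate_new_two (h : D.IsMove a b D') : D'.mate (new 2) = b.old := by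
  rw [← h.mate_right, D'.mate_mate]

theorem next_old (h : D.IsMove a b D') {d : HalfEdge t k} (ha : d ≠ a) (hb : d ≠ b) :
    D'.next d.old = (D.next d).old := by
  rw [Drawing.next, h.mate_old d ha hb, rot_old, Drawing.next]

theorem next_left (h : D.IsMove a b D') : D'.next a.old = new 1 := by
  rw [Drawing.next, h.mate_left]; rfl

theorem next_right (h : D.IsMove a b D') : D'.next b.old = new 3 := by
  rw [Drawing.next, h.mate_right]; rfl

theorem next_new_zero (h : D.IsMove a b D') : D'.next (new 0) = (D.next a).old := by
  rw [Drawing.next, h.mate_new_zero, rot_old, Drawing.next, h.isTip_left]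

theorem next_new_one (h : D.IsMove a b D') : D'.next (new 1) = new 2 := by
  rw [Drawing.next, h.isTip_new_one]; rfl

theorem next_new_two (h : D.IsMove a b D') : D'.next (new 2) = (D.next b).old := by
  rw [Drawing.next, h.mate_new_two, rot_old, Drawing.next, h.isTip_right]

theorem next_new_three (h : D.IsMove a b D') : D'.next (new 3) = new 0 := by
  rw [Drawing.next, h.isTip_new_three]; rfl

theorem region_left (h : D.IsMove a b D') : D'.region a.old (new 1) := by
  have := D'.region_rot_mate a.old
  rwa [← Drawing.next, h.next_left] at this

theorem region_right (h : D.IsMove a b D') : D'.region b.old (new 3) := by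
  have := D'.region_rot_mate b.old
  rwa [← Drawing.next, h.next_right] at this

theorem region_one_two (h : D.IsMove a b D') : D'.region (new 1) (new 2) := by
  have := D'.region_rot_mate (new 1)
  rwa [← Drawing.next, h.next_new_one] at this

theorem region_three_zero (h : D.IsMove a b D') : D'.region (new 3) (new 0) := by
  have := D'.region_rot_mate (new 3)
  rwa [← Drawing.next, h.next_new_three] at this

theorem region_new (h : D.IsMove a b D') (s : Fin 4) :
    D'.region (new s) (new 1) ∨ D'.region (new s) (new 3) := by
  fin_cases s
  · exact .inr (D'.region.symm h.region_three_zero)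
  · exact .inl (D'.region.refl _)
  · exact .inl (D'.region.symm h.region_one_two)
  · exact .inr (D'.region.refl _)

/-- `new 1` shares its region with `a` and `new 3` with `b`, so no region of the new drawing
consists of new half-edges only. Thus a move can only refine regions (`region_proj`). -/
theorem exists_old_region (h : D.IsMove a b D') (x : HalfEdge t (k + 1)) :
    ∃ d, D'.region x d.old ∧ D.region d (proj a x) := by
  induction x using cases_old_new with
  | old d => exact ⟨d, D'.region.refl _, by simp⟩
  | new s =>
    rcases h.region_new s with hs | hs
    · exact ⟨a, D'.region.trans hs (D'.region.symm h.region_left), by simp⟩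
    · exact ⟨b, D'.region.trans hs (D'.region.symm h.region_right),
        by simpa using D.region.symm h.region⟩

theorem region_proj (h : D.IsMove a b D') {x y : HalfEdge t (k + 1)} (hxy : D'.region x y) :
    D.region (proj a x) (proj a y) := by
  obtain ⟨d, hd, hd'⟩ := h.exists_old_region x
  obtain ⟨e, he, he'⟩ := h.exists_old_region y
  have := h.region_of_region d e
    (D'.region.trans (D'.region.symm hd) (D'.region.trans hxy he))
  exact D.region.trans (D.region.symm hd') (D.region.trans this he')

theorem isTip_old (h : D.IsMove a b D') {d : HalfEdge t k} :
    D'.IsTip d.old ↔ D.IsTip d ∧ d ≠ a ∧ d ≠ b := by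
  by_cases ha : d = a
  · subst ha; simp [IsTip, h.mate_left]
  by_cases hb : d = b
  · subst hb; simp [IsTip, h.mate_right]
  simp [IsTip, h.mate_old d ha hb, ha, hb]

theorem isTip_new (h : D.IsMove a b D') {s : Fin 4} :
    D'.IsTip (new s) ↔ s = 1 ∨ s = 3 := by
  fin_cases s
  · simp [IsTip, h.mate_new_zero]
  · simpa using h.isTip_new_one
  · simp [IsTip, h.mate_new_two]
  · simpa using h.isTip_new_three

/-- From an old half-edge whose boundary is not touched by the move, the same half-edges are
reached. -/
theorem sameBoundary_old (h : D.IsMove a b D') {d e : HalfEdge t k} (ha : ¬ D.SameBoundary d a)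
    (hb : ¬ D.SameBoundary d b) (hde : D.SameBoundary d e) : D'.SameBoundary d.old e.old := by
  obtain ⟨m, rfl⟩ := hde
  induction m with
  | zero => exact .refl ..
  | succ m ih =>
    refine ih.trans ⟨1, ?_⟩
    rw [Function.iterate_succ_apply' D.next, Function.iterate_one, h.next_old]
    exacts [fun h => ha ⟨m, h⟩, fun h => hb ⟨m, h⟩]

theorem sameBoundary_new (h : D.IsMove a b D') {d : HalfEdge t k}
    (hd : D.SameBoundary d a ∨ D.SameBoundary d b) :
    D'.SameBoundary d.old (new 1) ∨ D'.SameBoundary d.old (new 3) := by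
  obtain ⟨m, hm⟩ : ∃ m, D.next^[m] d = a ∨ D.next^[m] d = b := by
    rcases hd with ⟨m, hm⟩ | ⟨m, hm⟩
    exacts [⟨m, .inl hm⟩, ⟨m, .inr hm⟩]
  clear hd
  induction m generalizing d with
  | zero =>
    rcases hm with rfl | rfl
    exacts [.inl ⟨1, h.next_left⟩, .inr ⟨1, h.next_right⟩]
  | succ m ih =>
    by_cases ha : d = a
    · subst ha; exact .inl ⟨1, h.next_left⟩
    by_cases hb : d = b
    · subst hb; exact .inr ⟨1, h.next_right⟩
    have := SameBoundary.next D' d.old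
    rw [h.next_old ha hb] at this
    exact (ih hm).imp this.trans this.trans

theorem adj_old (h : D.IsMove a b D') {x y : Vertex n k} :
    D'.Adj (Sum.map id Fin.castSucc x) (Sum.map id Fin.castSucc y) ↔ D.Adj x y := by
  have hinj : Function.Injective (Sum.map id Fin.castSucc : Vertex n k → Vertex n (k + 1)) :=
    Function.Injective.sumMap Function.injective_id (Fin.castSucc_injective _)
  have hne : ∀ z : Vertex n k, Sum.map id Fin.castSucc z ≠ (.inr (Fin.last k) : Vertex n (k + 1)) := by
    rintro (z | z) hz
    · cases hz
    · exact (Fin.castSucc_lt_last z).ne (Sum.inr.inj hz)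
  constructor
  · rintro ⟨d, hd, hx, hy⟩
    induction d using cases_old_new with
    | new s => exact absurd hx.symm (hne _)
    | old d =>
      rw [h.isTip_old] at hd
      by_cases ha : d = a
      · subst ha
        rw [h.mate_left] at hy
        exact absurd hy.symm (hne _)
      by_cases hb : d = b
      · subst hb
        rw [h.mate_right] at hy
        exact absurd hy.symm (hne _)
      rw [h.mate_old d ha hb, vertex_old] at hy
      rw [vertex_old] at hx
      exact ⟨d, fun h => hd ⟨h, ha, hb⟩, hinj hx, hinj hy⟩
  · rintro ⟨d, hd, rfl, rfl⟩
    refine ⟨d.old, ?_, vertex_old _, ?_⟩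
    · rw [h.isTip_old]; tauto
    · rw [h.mate_old, vertex_old]
      · rintro rfl; exact hd h.isTip_left
      · rintro rfl; exact hd h.isTip_right

theorem adj_new (h : D.IsMove a b D') {x : Vertex n (k + 1)}
    (hx : D'.Adj (.inr (Fin.last k)) x) : x = a.old.vertex ∨ x = b.old.vertex := by
  obtain ⟨d, hd, hl, rfl⟩ := hx
  induction d using cases_old_new with
  | old d => exact absurd hl (vertex_old_ne_new d 0)
  | new s =>
    rw [h.isTip_new] at hd
    fin_cases s
    · exact .inl (by rw [← h.mate_new_zero]; rfl)
    · simp at hd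
    · exact .inr (by rw [← h.mate_new_two]; rfl)
    · simp at hd

/-- The new vertex has no neighbours but the vertices of `a` and `b`. A triangle through it needs an
edge between these two, and a parallel pair needs them to coincide. This is the criterion for a move
to be legal in the final position. -/
theorem sparse (h : D.IsMove a b D') (hD : D.Sparse) (hne : a.vertex ≠ b.vertex)
    (hadj : ¬ D.Adj a.vertex b.vertex) : D'.Sparse := by
  have hcase : ∀ x : Vertex n (k + 1), x = .inr (Fin.last k) ∨
      ∃ y : Vertex n k, x = Sum.map id Fin.castSucc y := by
    rintro (i | j)
    · exact .inr ⟨.inl i, rfl⟩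
    · induction j using Fin.lastCases with
      | last => exact .inl rfl
      | cast j => exact .inr ⟨.inr j, rfl⟩
  have hself : ∀ x, ¬ D'.Adj x x := by
    intro x hx
    rcases hcase x with rfl | ⟨y, rfl⟩
    · rcases h.adj_new hx with h' | h'
      exacts [vertex_old_ne_new a 0 h'.symm, vertex_old_ne_new b 0 h'.symm]
    · exact hD.not_adj_self y (h.adj_old.1 hx)
  have hab : ¬ D'.Adj a.old.vertex b.old.vertex := by
    rwa [vertex_old, vertex_old, h.adj_old]
  have htri : ∀ y z, D'.Adj (.inr (Fin.last k)) y → D'.Adj y z →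
      ¬ D'.Adj z (.inr (Fin.last k)) := by
    intro y z h1 h2 h3
    rcases h.adj_new h1 with rfl | rfl <;> rcases h.adj_new h3.symm with rfl | rfl
    exacts [hself _ h2, hab h2, hab h2.symm, hself _ h2]
  refine ⟨hself, ?_, ?_⟩
  · have hnew : ∀ s s' : Fin 4, ¬ D'.IsTip (new s) → ¬ D'.IsTip (new s') →
        (D'.mate (new s)).vertex = (D'.mate (new s')).vertex → s = s' := by
      intro s s' hs hs' hv
      rw [h.isTip_new] at hs hs'
      have h02 : ∀ s : Fin 4, ¬ (s = 1 ∨ s = 3) → s = 0 ∨ s = 2 := by decide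
      rcases h02 s hs with rfl | rfl <;> rcases h02 s' hs' with rfl | rfl
      · rfl
      · rw [h.mate_new_zero, h.mate_new_two, vertex_old_inj] at hv
        exact absurd hv hne
      · rw [h.mate_new_zero, h.mate_new_two, vertex_old_inj] at hv
        exact absurd hv.symm hne
      · rfl
    have hmate : ∀ d, ¬ D'.IsTip d.old → (∃ s, D'.mate d.old = new s) ∨
        ¬ D.IsTip d ∧ D'.mate d.old = (D.mate d).old := by
      intro d hd
      by_cases ha : d = a
      · subst ha; exact .inl ⟨_, h.mate_left⟩
      by_cases hb : d = b
      · subst hb; exact .inl ⟨_, h.mate_right⟩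
      exact .inr ⟨fun h' => hd (h.isTip_old.2 ⟨h', ha, hb⟩), h.mate_old d ha hb⟩
    intro d e hd he hv hm
    induction d using cases_old_new with
    | new s =>
      induction e using cases_old_new with
      | new s' => rw [hnew s s' hd he hm]
      | old e => exact absurd hv.symm (vertex_old_ne_new e s)
    | old d =>
      induction e using cases_old_new with
      | new s' => exact absurd hv (vertex_old_ne_new d s')
      | old e =>
        rcases hmate d hd with ⟨s, hs⟩ | ⟨hd', hs⟩ <;> rcases hmate e he with ⟨s', hs'⟩ | ⟨he', hs'⟩
        · have h1 : d.old = D'.mate (new s) := by rw [← hs, D'.mate_mate]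
          have h2 : e.old = D'.mate (new s') := by rw [← hs', D'.mate_mate]
          have : s = s' := by
            refine hnew s s' ?_ ?_ ?_
            · rwa [← hs, isTip_mate]
            · rwa [← hs', isTip_mate]
            · rw [← h1, ← h2, hv]
          rw [h1, h2, this]
        · rw [hs, hs'] at hm
          exact absurd hm.symm (vertex_old_ne_new _ s)
        · rw [hs, hs'] at hm
          exact absurd hm (vertex_old_ne_new _ s')
        · rw [hs, hs', vertex_old_inj] at hm
          rw [hD.eq_of_vertex d e hd' he' (vertex_old_inj.1 hv) hm]
  · intro x y z hxy hyz hzx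
    rcases hcase x with rfl | ⟨x, rfl⟩
    · exact htri _ _ hxy hyz hzx
    rcases hcase y with rfl | ⟨y, rfl⟩
    · exact htri _ _ hyz hzx hxy
    rcases hcase z with rfl | ⟨z, rfl⟩
    · exact htri _ _ hzx hxy hyz
    exact hD.no_triangle _ _ _ (h.adj_old.1 hxy) (h.adj_old.1 hyz) (h.adj_old.1 hzx)

end IsMove

/-! ### Existence of moves -/

/-- Following the boundary from `d`, one meets `a` without meeting `b` before. -/
def ReachesFirst (D : Drawing t k) (a b d : HalfEdge t k) : Prop :=
  ∃ m, D.next^[m] d = a ∧ ∀ j ≤ m, D.next^[j] d ≠ b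

theorem reachesFirst_next {d : HalfEdge t k} (ha : d ≠ a) (hb : d ≠ b) :
    D.ReachesFirst a b (D.next d) ↔ D.ReachesFirst a b d := by
  constructor
  · rintro ⟨m, hm, hj⟩
    refine ⟨m + 1, hm, fun j hjm => ?_⟩
    rcases j with _ | j
    · exact hb
    · exact hj j (by omega)
  · rintro ⟨m, hm, hj⟩
    rcases m with _ | m
    · exact absurd hm ha
    · exact ⟨m, hm, fun j hjm => hj (j + 1) (by omega)⟩

/-- If `a` came before `b`, the walk from `D.next a` would close up at `a` without ever meeting `b`.
-/
theorem not_reachesFirst_next_left (h : D.SameBoundary a b) :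
    ¬ D.ReachesFirst a b (D.next a) := by
  rintro ⟨m, hm, hj⟩
  have : ∀ l, ∃ j ≤ m, D.next^[l] (D.next a) = D.next^[j] (D.next a) := by
    intro l
    induction l with
    | zero => exact ⟨0, by omega, rfl⟩
    | succ l ih =>
      obtain ⟨j, hjm, ih⟩ := ih
      rw [Function.iterate_succ_apply', ih]
      rcases hjm.eq_or_lt with rfl | hlt
      · exact ⟨0, by omega, by rw [hm]; rfl⟩
      · exact ⟨j + 1, hlt, by rw [Function.iterate_succ_apply']⟩
  obtain ⟨l, hl⟩ := (SameBoundary.next D a).symm.trans h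
  obtain ⟨j, hjm, h'⟩ := this l
  exact hj j hjm (h'.symm.trans hl)

theorem reachesFirst_next_right (hne : a ≠ b) (h : D.SameBoundary a b) :
    D.ReachesFirst a b (D.next b) := by
  classical
  have hex : ∃ m, D.next^[m] (D.next b) = a :=
    (SameBoundary.next D b).symm.trans h.symm
  refine ⟨Nat.find hex, Nat.find_spec hex, fun j hj hjb => ?_⟩
  rcases hj.eq_or_lt with rfl | hlt
  · exact hne ((Nat.find_spec hex).symm.trans hjb)
  · refine Nat.find_min hex (m := Nat.find hex - (j + 1)) (by omega) ?_
    have := Nat.find_spec hex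
    rw [show Nat.find hex = (Nat.find hex - (j + 1)) + (j + 1) by omega,
      Function.iterate_add_apply, Function.iterate_succ_apply', hjb] at this
    exact this

open scoped Classical in
/-- Two distinct open tips in the same region can be joined by a curve with a crossbar. -/
theorem exists_isMove (ha : D.IsTip a) (hb : D.IsTip b) (hne : a ≠ b) (hr : D.region a b) :
    ∃ D' : Drawing t (k + 1), D.IsMove a b D' := by
  let mate' : HalfEdge t (k + 1) → HalfEdge t (k + 1) := fun x =>
    Sum.elim (fun d => if d = a then new 0 else if d = b then new 2 else (D.mate d).old)
      ![a.old, new 1, b.old, new 3] x.decode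
  have m0 : mate' a.old = new 0 := by simp [mate']
  have m2 : mate' b.old = new 2 := by simp [mate', hne.symm]
  have mold : ∀ d, d ≠ a → d ≠ b → mate' d.old = (D.mate d).old := by
    intro d h1 h2; simp [mate', h1, h2]
  have n0 : mate' (new 0) = a.old := by simp [mate']
  have n1 : mate' (new 1) = new 1 := by simp [mate']
  have n2 : mate' (new 2) = b.old := by simp [mate']
  have n3 : mate' (new 3) = new 3 := by simp [mate']
  -- The side of `new 1` receives the part of the cut boundary that runs from `b` to `a`. On every
  -- other boundary component `ReachesFirst` fails, so all of these go to the side of `new 3`.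
  let side : HalfEdge t (k + 1) → Prop := fun x =>
    Sum.elim (fun d => D.ReachesFirst a b d) (fun s => s = 1 ∨ s = 2) x.decode
  -- The second entry is false unless the curve separates and the half-edge lies in the region of
  -- `a`; so other regions persist, and a merging curve splits nothing.
  let label : HalfEdge t (k + 1) → Quotient D.region × Prop := fun x =>
    (⟦proj a x⟧, D.SameBoundary a b ∧ D.region a (proj a x) ∧ side x)
  have sold : ∀ d : HalfEdge t k, side d.old = D.ReachesFirst a b d := by intro d; simp [side]
  have snew : ∀ s : Fin 4, side (new s : HalfEdge t (k + 1)) = (s = 1 ∨ s = 2) := by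
    intro s; simp [side]
  have hnext : ∀ d, D.region d (D.next d) := D.region_rot_mate
  have hlabel : ∀ x y, D.region (proj a x) (proj a y) → (D.SameBoundary a b → (side x ↔ side y)) →
      label x = label y := by
    intro x y h1 h2
    simp only [label, Prod.mk.injEq]
    refine ⟨Quotient.sound h1, propext (and_congr_right fun h => and_congr ?_ (h2 h))⟩
    exact ⟨fun h => D.region.trans h h1, fun h => D.region.trans h (D.region.symm h1)⟩
  let D' : Drawing t (k + 1) :=
    { mate := mate'
      mate_mate := by
        intro x
        induction x using cases_old_new with
        | old d =>
          by_cases h1 : d = a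
          · rw [h1, m0, n0]
          by_cases h2 : d = b
          · rw [h2, m2, n2]
          rw [mold d h1 h2, mold _ (ha.mate_ne h1) (hb.mate_ne h2), D.mate_mate]
        | new s =>
          fin_cases s
          · exact (congrArg mate' n0).trans m0
          · exact (congrArg mate' n1).trans n1
          · exact (congrArg mate' n2).trans m2
          · exact (congrArg mate' n3).trans n3
      region := Setoid.ker label
      region_rot_mate := by
        intro x
        rw [Setoid.ker_def]
        have hra : a.rot = D.next a := by rw [Drawing.next, ha]
        have hrb : b.rot = D.next b := by rw [Drawing.next, hb]
        induction x using cases_old_new with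
        | old d =>
          by_cases h1 : d = a
          · rw [h1, m0, rot_new]
            refine hlabel _ _ (by simp) fun h => ?_
            rw [sold, snew]
            refine iff_of_true ⟨0, rfl, fun j hj => ?_⟩ (by decide)
            obtain rfl : j = 0 := by omega
            exact hne
          by_cases h2 : d = b
          · rw [h2, m2, rot_new]
            refine hlabel _ _ (by simpa using D.region.symm hr) fun h => ?_
            rw [sold, snew]
            refine iff_of_false ?_ (by decide)
            rintro ⟨m, -, hj⟩
            exact hj 0 (by omega) rfl
          rw [mold d h1 h2, rot_old]
          refine hlabel _ _ (by simpa [Drawing.next] using hnext d) fun h => ?_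
          rw [sold, sold]
          exact (reachesFirst_next h1 h2).symm
        | new s =>
          fin_cases s
          · show label (new 0) = label (mate' (new 0)).rot
            rw [n0, rot_old, hra]
            refine hlabel _ _ (by simpa using hnext a) fun h => ?_
            rw [sold, snew]
            exact iff_of_false (by decide) (not_reachesFirst_next_left h)
          · show label (new 1) = label (mate' (new 1)).rot
            rw [n1, rot_new]
            refine hlabel _ _ (by simp) fun h => ?_
            rw [snew, snew]; decide
          · show label (new 2) = label (mate' (new 2)).rot
            rw [n2, rot_old, hrb]
            refine hlabel _ _ (by simpa using D.region.trans hr (hnext b)) fun h => ?_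
            rw [sold, snew]
            exact iff_of_true (by decide) (reachesFirst_next_right hne h)
          · show label (new 3) = label (mate' (new 3)).rot
            rw [n3, rot_new]
            refine hlabel _ _ (by simp) fun h => ?_
            rw [snew, snew]; decide }
  have hreg : ∀ x y, D'.region x y ↔ label x = label y := fun x y => Setoid.ker_def
  refine ⟨D', ⟨ha, hb, hne, hr, m0, m2, n1, n3, mold, ?_, ?_, ?_, ?_⟩⟩
  · intro d e h
    have := congrArg Prod.fst ((hreg _ _).1 h)
    exact Quotient.exact (by simpa [label] using this)
  · intro d e h1 h2
    rw [hreg]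
    simp only [label, Prod.mk.injEq, proj_old]
    refine ⟨Quotient.sound h2, propext ⟨fun h => absurd h.2.1 h1, fun h => absurd ?_ h1⟩⟩
    exact D.region.trans h.2.1 (D.region.symm h2)
  · intro d h
    rw [hreg, hreg]
    by_cases hs : side d.old
    · refine .inl (hlabel _ _ (by simpa using h) fun _ => iff_of_true ?_ hs)
      rw [snew]; decide
    · refine .inr (hlabel _ _ (by simpa using h) fun _ => iff_of_false ?_ hs)
      rw [snew]; decide
  · rw [hreg]
    constructor
    · intro h
      by_contra hb
      exact h (hlabel _ _ (by simp) fun h => absurd h hb)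
    · intro h h'
      have := congrArg Prod.snd h'
      simp only [label, snew, proj_new, eq_iff_iff] at this
      have h3 := (this.1 ⟨h, D.region.refl _, by decide⟩).2.2
      exact absurd h3 (by decide)

end Drawing

end BrusselsSprout

/-! ### The Euler count, with dimensions of function spaces -/

namespace BrusselsSprout

variable {n : ℕ} {t : Fin n → ℕ} {k : ℕ}

open HalfEdge Module

namespace Drawing

variable {D : Drawing t k} {a b : HalfEdge t k} {D' : Drawing t (k + 1)}

/-- The functions that are constant on the regions. -/
def regionFun (D : Drawing t k) : Submodule ℚ (HalfEdge t k → ℚ) where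
  carrier := {f | ∀ d e, D.region d e → f d = f e}
  add_mem' hf hg d e h := by simp [hf d e h, hg d e h]
  zero_mem' _ _ _ := rfl
  smul_mem' c f hf d e h := by simp [hf d e h]

/-- The functions that are constant on the connected components of the drawing. -/
def compFun (D : Drawing t k) : Submodule ℚ (HalfEdge t k → ℚ) where
  carrier := {g | ∀ d, g d.rot = g d ∧ g (D.mate d) = g d}
  add_mem' hf hg d := by simp [(hf d).1, (hf d).2, (hg d).1, (hg d).2]
  zero_mem' _ := ⟨rfl, rfl⟩
  smul_mem' c f hf d := by simp [(hf d).1, (hf d).2]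

theorem compFun_sameBoundary {g : HalfEdge t k → ℚ} (hg : g ∈ D.compFun) {d e : HalfEdge t k}
    (h : D.SameBoundary d e) : g d = g e :=
  h.of_setoid (r := fun d e => g d = g e) ⟨fun _ => rfl, Eq.symm, Eq.trans⟩
    fun d => ((hg (D.mate d)).1.trans (hg d).2).symm

theorem compFun_vertex {g : HalfEdge t k → ℚ} (hg : g ∈ D.compFun) {d e : HalfEdge t k}
    (h : d.vertex = e.vertex) : g d = g e := by
  obtain ⟨m, rfl⟩ := exists_rot_iterate h
  clear h
  induction m with
  | zero => rfl
  | succ m ih => rw [Function.iterate_succ_apply', (hg _).1, ih]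

theorem compFun_adj {g : HalfEdge t k → ℚ} (hg : g ∈ D.compFun) {d e : HalfEdge t k}
    (h : D.Adj d.vertex e.vertex) : g d = g e := by
  obtain ⟨x, -, h1, h2⟩ := h
  rw [← compFun_vertex hg h1, ← compFun_vertex hg h2, (hg x).2]

/-- The Euler inequality for the incidence of regions and components along boundaries. -/
theorem finrank_regionFun_add_finrank_compFun_le [Nonempty (HalfEdge t k)]
    (hj : ∀ f ∈ D.regionFun, f ∈ D.compFun → ∀ x y, f x = f y)
    (T : Finset (HalfEdge t k)) (hT : ∀ d, ∃ x ∈ T, D.SameBoundary d x) :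
    finrank ℚ D.regionFun + finrank ℚ D.compFun ≤ T.card + 1 := by
  -- Boundary components are the edges of a bipartite graph on regions and components. `L` is its
  -- coboundary map, restricted to the representatives `T`; its kernel consists of functions
  -- constant on regions and on components, hence of constants by `hj`.
  let L : (D.regionFun × D.compFun) →ₗ[ℚ] (T → ℚ) :=
    { toFun := fun p x => p.1.1 x - p.2.1 x
      map_add' := by intro p q; ext x; simp; ring
      map_smul' := by intro c p; ext x; simp; ring }
  have h1 : finrank ℚ (LinearMap.range L) ≤ T.card := by
    simpa using Submodule.finrank_le (LinearMap.range L)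
  have h2 : finrank ℚ (LinearMap.ker L) ≤ 1 := by
    obtain ⟨x₀⟩ := ‹Nonempty (HalfEdge t k)›
    let e : LinearMap.ker L →ₗ[ℚ] ℚ :=
      { toFun := fun p => p.1.1.1 x₀
        map_add' := by intro p q; simp
        map_smul' := by intro c p; simp }
    have := LinearMap.finrank_le_finrank_of_injective (f := e) ?_
    · simpa using this
    · refine (injective_iff_map_eq_zero _).2 ?_
      rintro ⟨⟨f, g⟩, hp⟩ h0
      have hfg : f.1 = g.1 := by
        ext d
        obtain ⟨x, hx, hdx⟩ := hT d
        have := congrFun (LinearMap.mem_ker.1 hp) ⟨x, hx⟩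
        rw [f.2 d x hdx.region, compFun_sameBoundary g.2 hdx]
        exact sub_eq_zero.1 this
      have hf : f.1 = 0 := by
        ext d
        exact (hj f.1 f.2 (hfg ▸ g.2) d x₀).trans h0
      ext d
      · exact congrFun hf d
      · exact congrFun (hfg.symm.trans hf) d
  have h3 := LinearMap.finrank_range_add_finrank_ker L
  rw [finrank_prod] at h3
  omega

theorem finrank_regionFun_le (T : Finset (HalfEdge t k))
    (hT : ∀ d, ∃ x ∈ T, D.SameBoundary d x) : finrank ℚ D.regionFun ≤ T.card := by
  let L : D.regionFun →ₗ[ℚ] (T → ℚ) :=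
    { toFun := fun p x => p.1 x
      map_add' := by intro p q; ext x; simp
      map_smul' := by intro c p; ext x; simp }
  have := LinearMap.finrank_le_finrank_of_injective (f := L) ?_
  · simpa using this
  · refine (injective_iff_map_eq_zero _).2 ?_
    rintro f h0
    ext d
    obtain ⟨x, hx, hdx⟩ := hT d
    rw [f.2 d x hdx.region]
    exact congrFun h0 ⟨x, hx⟩

namespace IsMove

/-- Functions pulled back from the old regions are independent of the indicator of the region of
`new 1`: they take the same value at `new 1` and `new 3`, and the indicator does not. -/
theorem finrank_regionFun_le_of_not_region (h : D.IsMove a b D')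
    (hs : ¬ D'.region (new 1) (new 3)) :
    finrank ℚ D.regionFun + 1 ≤ finrank ℚ D'.regionFun := by
  classical
  let L : (D.regionFun × ℚ) →ₗ[ℚ] D'.regionFun :=
    { toFun := fun p => ⟨fun x => p.1.1 (proj a x) + if D'.region (new 1) x then p.2 else 0, by
        intro x y hxy
        have h1 := p.1.2 _ _ (h.region_proj hxy)
        have h2 : D'.region (new 1) x ↔ D'.region (new 1) y :=
          ⟨fun h => D'.region.trans h hxy, fun h => D'.region.trans h (D'.region.symm hxy)⟩
        simp only [h1, h2]⟩
      map_add' := by intro p q; ext x; simp; split_ifs <;> ring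
      map_smul' := by intro c p; ext x; simp; split_ifs <;> ring }
  have := LinearMap.finrank_le_finrank_of_injective (f := L) ?_
  · simpa [finrank_prod] using this
  · refine (injective_iff_map_eq_zero _).2 ?_
    rintro ⟨f, c⟩ h0
    have hx : ∀ x, f.1 (proj a x) + (if D'.region (new 1) x then c else 0) = 0 := fun x =>
      congrFun (congrArg Subtype.val h0) x
    have h3 := hx (new 3)
    rw [if_neg hs, proj_new, add_zero] at h3
    have h1 := hx (new 1)
    rw [if_pos (D'.region.refl _), proj_new, h3, zero_add] at h1
    subst h1
    ext d
    · simpa using hx d.old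
    · rfl

theorem finrank_regionFun_le (h : D.IsMove a b D') :
    finrank ℚ D.regionFun ≤ finrank ℚ D'.regionFun := by
  let L : D.regionFun →ₗ[ℚ] D'.regionFun :=
    { toFun := fun p => ⟨fun x => p.1 (proj a x), fun x y hxy => p.2 _ _ (h.region_proj hxy)⟩
      map_add' := by intro p q; ext x; simp
      map_smul' := by intro c p; ext x; simp }
  refine LinearMap.finrank_le_finrank_of_injective (f := L) ?_
  refine (injective_iff_map_eq_zero _).2 ?_
  intro f h0
  ext d
  simpa [L] using congrFun (congrArg Subtype.val h0) d.old

theorem comp_proj_mem_compFun (h : D.IsMove a b D') {g : HalfEdge t k → ℚ} (hg : g ∈ D.compFun)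
    (hab : g a = g b) : (fun x => g (proj a x)) ∈ D'.compFun := by
  intro x
  induction x using cases_old_new with
  | old d =>
    refine ⟨by simpa [rot_old] using (hg d).1, ?_⟩
    by_cases ha : d = a
    · subst ha; simp [h.mate_left]
    by_cases hb : d = b
    · subst hb; simp [h.mate_right, hab]
    simpa [h.mate_old d ha hb] using (hg d).2
  | new s =>
    refine ⟨by simp [rot_new], ?_⟩
    fin_cases s
    · simp [h.mate_new_zero]
    · simp [show D'.mate (new 1) = new 1 from h.isTip_new_one]
    · simp [h.mate_new_two, hab]
    · simp [show D'.mate (new 3) = new 3 from h.isTip_new_three]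

/-- The functions in `D.compFun` that agree at `a` and `b` extend to the next drawing. -/
theorem exists_ker_finrank_le (h : D.IsMove a b D') :
    ∃ φ : D.compFun →ₗ[ℚ] ℚ, (∀ g, φ g = g.1 a - g.1 b) ∧
      finrank ℚ (LinearMap.ker φ) ≤ finrank ℚ D'.compFun := by
  let φ : D.compFun →ₗ[ℚ] ℚ :=
    { toFun := fun g => g.1 a - g.1 b
      map_add' := by intro p q; simp; ring
      map_smul' := by intro c p; simp; ring }
  refine ⟨φ, fun g => rfl, ?_⟩
  let L : LinearMap.ker φ →ₗ[ℚ] D'.compFun :=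
    { toFun := fun g => ⟨fun x => g.1.1 (proj a x), h.comp_proj_mem_compFun g.1.2
        (sub_eq_zero.1 (LinearMap.mem_ker.1 g.2))⟩
      map_add' := by intro p q; ext x; simp
      map_smul' := by intro c p; ext x; simp }
  refine LinearMap.finrank_le_finrank_of_injective (f := L) ?_
  refine (injective_iff_map_eq_zero _).2 ?_
  intro f h0
  ext d
  simpa [L] using congrFun (congrArg Subtype.val h0) d.old

theorem finrank_compFun_le_succ (h : D.IsMove a b D') :
    finrank ℚ D.compFun ≤ finrank ℚ D'.compFun + 1 := by
  obtain ⟨φ, -, hφ⟩ := h.exists_ker_finrank_le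
  have h1 := LinearMap.finrank_range_add_finrank_ker φ
  have h2 := Submodule.finrank_le (LinearMap.range φ)
  rw [finrank_self] at h2
  omega

theorem finrank_compFun_le (h : D.IsMove a b D') (hab : ∀ g ∈ D.compFun, g a = g b) :
    finrank ℚ D.compFun ≤ finrank ℚ D'.compFun := by
  obtain ⟨φ, hφ', hφ⟩ := h.exists_ker_finrank_le
  have : LinearMap.ker φ = ⊤ := by
    rw [LinearMap.ker_eq_top]
    ext g
    rw [hφ', hab _ g.2, sub_self]; rfl
  rwa [this, finrank_top] at hφ

/-- Since `new 1` and `new 3` share a vertex, `f` agrees on the two sides of the curve; so its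
restriction to old half-edges is constant on the old regions, even on one that was split. -/
theorem joined (h : D.IsMove a b D')
    (hj : ∀ f ∈ D.regionFun, f ∈ D.compFun → ∀ x y, f x = f y)
    (f : HalfEdge t (k + 1) → ℚ) (hr : f ∈ D'.regionFun) (hc : f ∈ D'.compFun)
    (x y : HalfEdge t (k + 1)) : f x = f y := by
  have h13 : f (new 1) = f (new 3) := compFun_vertex hc rfl
  have hreg : ∀ d, D.region a d → f d.old = f (new 3) := by
    intro d hd
    rcases h.region_split d hd with h' | h'
    · rw [← h13]; exact (hr _ _ h').symm
    · exact (hr _ _ h').symm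
  have key : ∀ d e : HalfEdge t k, f d.old = f e.old := by
    refine hj (fun d => f d.old) ?_ ?_
    · intro d e hde
      by_cases hd : D.region a d
      · exact (hreg d hd).trans (hreg e (D.region.trans hd hde)).symm
      · exact hr _ _ (h.region_persists d e hd hde)
    · intro d
      refine ⟨by simpa [rot_old] using (hc d.old).1, ?_⟩
      by_cases ha : d = a
      · subst ha; exact congrArg (fun d => f (old d)) h.isTip_left
      by_cases hb : d = b
      · subst hb; exact congrArg (fun d => f (old d)) h.isTip_right
      simpa [h.mate_old d ha hb] using (hc d.old).2
  have hall : ∀ x, f x = f a.old := by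
    intro x
    induction x using cases_old_new with
    | old d => exact key _ _
    | new s =>
      rw [compFun_vertex hc (show (new s).vertex = (new 0 : HalfEdge t (k + 1)).vertex from rfl),
        ← h.mate_left, (hc _).2]
  rw [hall x, hall y]

/-- The representatives of the cut boundary, at least one in number, give way to the two arms of the
crossbar, one on each new boundary. -/
theorem exists_transversal_of_sameBoundary (h : D.IsMove a b D') (hab : D.SameBoundary a b)
    {T : Finset (HalfEdge t k)} (hT : ∀ x ∈ T, D.IsTip x)
    (hT' : ∀ d, ∃ x ∈ T, D.SameBoundary d x) :
    ∃ T' : Finset (HalfEdge t (k + 1)), (∀ x ∈ T', D'.IsTip x) ∧ T'.card ≤ T.card + 1 ∧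
      ∀ d, ∃ x ∈ T', D'.SameBoundary d x := by
  classical
  obtain ⟨τ, hτ, haτ⟩ := hT' a
  refine ⟨(T.filter fun x => ¬ D.SameBoundary a x).image old ∪ {new 1, new 3}, ?_, ?_, ?_⟩
  · intro x hx
    simp only [Finset.mem_union, Finset.mem_image, Finset.mem_filter, Finset.mem_insert,
      Finset.mem_singleton] at hx
    rcases hx with ⟨d, ⟨hd, hda⟩, rfl⟩ | rfl | rfl
    · refine h.isTip_old.2 ⟨hT d hd, ?_, ?_⟩
      · rintro rfl; exact hda (.refl ..)
      · rintro rfl; exact hda hab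
    exacts [h.isTip_new_one, h.isTip_new_three]
  · have h1 : (T.filter fun x => ¬ D.SameBoundary a x).card < T.card :=
      Finset.card_lt_card (Finset.filter_ssubset.2 ⟨τ, hτ, by simpa using haτ⟩)
    have h2 := Finset.card_union_le ((T.filter fun x => ¬ D.SameBoundary a x).image old)
      ({new 1, new 3} : Finset (HalfEdge t (k + 1)))
    have h3 := Finset.card_image_le (s := T.filter fun x => ¬ D.SameBoundary a x)
      (f := (old : HalfEdge t k → HalfEdge t (k + 1)))
    have h4 := Finset.card_le_two (a := (new 1 : HalfEdge t (k + 1))) (b := new 3)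
    omega
  · have hold : ∀ d : HalfEdge t k, ∃ x ∈ (T.filter fun x => ¬ D.SameBoundary a x).image old ∪
        {new 1, new 3}, D'.SameBoundary d.old x := by
      intro d
      by_cases hd : D.SameBoundary d a
      · rcases h.sameBoundary_new (.inl hd) with h' | h'
        exacts [⟨_, by simp, h'⟩, ⟨_, by simp, h'⟩]
      · obtain ⟨x, hx, hdx⟩ := hT' d
        refine ⟨x.old, ?_, h.sameBoundary_old hd (fun h' => hd (h'.trans hab.symm)) hdx⟩
        simpa using ⟨hx, fun h' => hd (hdx.trans h'.symm)⟩
    intro d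
    induction d using cases_old_new with
    | old d => exact hold d
    | new s =>
      fin_cases s
      · obtain ⟨x, hx, h'⟩ := hold (D.next a)
        exact ⟨x, hx, .trans ⟨1, h.next_new_zero⟩ h'⟩
      · exact ⟨_, by simp, .refl ..⟩
      · obtain ⟨x, hx, h'⟩ := hold (D.next b)
        exact ⟨x, hx, .trans ⟨1, h.next_new_two⟩ h'⟩
      · exact ⟨_, by simp, .refl ..⟩

theorem sameBoundary_new_one (h : D.IsMove a b D') {d : HalfEdge t k}
    (hb : ¬ D.SameBoundary d b) (ha : D.SameBoundary d a) : D'.SameBoundary d.old (new 1) := by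
  obtain ⟨m, hm⟩ := ha
  induction m generalizing d with
  | zero => exact ⟨1, (show d = a from hm) ▸ h.next_left⟩
  | succ m ih =>
    by_cases hda : d = a
    · exact ⟨1, hda ▸ h.next_left⟩
    have := SameBoundary.next D' d.old
    rw [h.next_old hda fun hdb => hb (hdb ▸ .refl ..)] at this
    exact this.trans (ih (fun h' => hb ((SameBoundary.next D d).trans h')) hm)

/-- The boundaries of `a` and `b` become one, so at least two representatives give way to the single
tip `new 1`. -/
theorem exists_transversal_of_not_sameBoundary (h : D.IsMove a b D')
    (hab : ¬ D.SameBoundary a b) {T : Finset (HalfEdge t k)} (hT : ∀ x ∈ T, D.IsTip x)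
    (hT' : ∀ d, ∃ x ∈ T, D.SameBoundary d x) :
    ∃ T' : Finset (HalfEdge t (k + 1)), (∀ x ∈ T', D'.IsTip x) ∧ T'.card + 1 ≤ T.card ∧
      ∀ d, ∃ x ∈ T', D'.SameBoundary d x := by
  classical
  obtain ⟨τ, hτ, haτ⟩ := hT' a
  obtain ⟨υ, hυ, hbυ⟩ := hT' b
  have hne : τ ≠ υ := by rintro rfl; exact hab (haτ.trans hbυ.symm)
  set U := T.filter fun x => ¬ (D.SameBoundary a x ∨ D.SameBoundary b x) with hU
  -- The walk runs from `new 3` through `new 0` and round the old boundary of `a`, which avoids `b`,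
  -- to `a` and then `new 1`.
  have h31 : D'.SameBoundary (new 3) (new 1) := by
    have h1 := h.sameBoundary_new_one (fun h' => hab ((SameBoundary.next D a).trans h'))
      (SameBoundary.next D a).symm
    exact .trans ⟨1, h.next_new_three⟩ (.trans ⟨1, h.next_new_zero⟩ h1)
  have hold : ∀ d : HalfEdge t k, ∃ x ∈ insert (new 1) (U.image old), D'.SameBoundary d.old x := by
    intro d
    by_cases hd : D.SameBoundary d a ∨ D.SameBoundary d b
    · rcases h.sameBoundary_new hd with h' | h'
      exacts [⟨_, by simp, h'⟩, ⟨new 1, by simp, h'.trans h31⟩]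
    · rw [not_or] at hd
      obtain ⟨x, hx, hdx⟩ := hT' d
      refine ⟨x.old, ?_, h.sameBoundary_old hd.1 hd.2 hdx⟩
      simp only [Finset.mem_insert, old_ne_new, Finset.mem_image, old_inj, exists_eq_right,
        false_or, hU, Finset.mem_filter, not_or]
      exact ⟨hx, fun h' => hd.1 (hdx.trans h'.symm), fun h' => hd.2 (hdx.trans h'.symm)⟩
  refine ⟨insert (new 1) (U.image old), ?_, ?_, ?_⟩
  · intro x hx
    simp only [Finset.mem_insert, Finset.mem_image, hU, Finset.mem_filter, not_or] at hx
    rcases hx with rfl | ⟨d, ⟨hd, hda, hdb⟩, rfl⟩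
    · exact h.isTip_new_one
    · refine h.isTip_old.2 ⟨hT d hd, ?_, ?_⟩
      · rintro rfl; exact hda (.refl ..)
      · rintro rfl; exact hdb (.refl ..)
  · have h1 : U ⊆ (T.erase τ).erase υ := by
      intro x hx
      simp only [hU, Finset.mem_filter, not_or] at hx
      simp only [Finset.mem_erase]
      refine ⟨?_, ?_, hx.1⟩
      · rintro rfl; exact hx.2.2 hbυ
      · rintro rfl; exact hx.2.1 haτ
    have h2 := Finset.card_le_card h1
    rw [Finset.card_erase_of_mem (Finset.mem_erase.2 ⟨hne.symm, hυ⟩),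
      Finset.card_erase_of_mem hτ] at h2
    have h3 := Finset.card_image_le (s := U) (f := (old : HalfEdge t k → HalfEdge t (k + 1)))
    have h4 := Finset.card_insert_le (new 1) (U.image (old : HalfEdge t k → HalfEdge t (k + 1)))
    have h5 : 1 < T.card := Finset.one_lt_card.2 ⟨τ, hτ, υ, hυ, hne⟩
    omega
  · intro d
    induction d using cases_old_new with
    | old d => exact hold d
    | new s =>
      fin_cases s
      · obtain ⟨x, hx, h'⟩ := hold (D.next a)
        exact ⟨x, hx, .trans ⟨1, h.next_new_zero⟩ h'⟩
      · exact ⟨_, by simp, .refl ..⟩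
      · obtain ⟨x, hx, h'⟩ := hold (D.next b)
        exact ⟨x, hx, .trans ⟨1, h.next_new_two⟩ h'⟩
      · exact ⟨new 1, by simp, h31⟩

theorem ncard_isTip_le (h : D.IsMove a b D') :
    {d | D'.IsTip d}.ncard ≤ {d | D.IsTip d}.ncard := by
  have h1 : {d | D'.IsTip d} ⊆ old '' ({d | D.IsTip d} \ {a, b}) ∪ {new 1, new 3} := by
    intro x hx
    induction x using cases_old_new with
    | old d =>
      have := h.isTip_old.1 hx
      exact .inl ⟨d, ⟨this.1, by simpa using this.2⟩, rfl⟩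
    | new s => exact .inr (by simpa using h.isTip_new.1 hx)
  have h2 := Set.ncard_le_ncard h1 (Set.toFinite _)
  have h3 := Set.ncard_union_le (old '' ({d | D.IsTip d} \ {a, b}))
    ({new 1, new 3} : Set (HalfEdge t (k + 1)))
  have h4 := Set.ncard_image_le (s := {d | D.IsTip d} \ {a, b})
    (f := (old : HalfEdge t k → HalfEdge t (k + 1))) (Set.toFinite _)
  have h5 : ({a, b} : Set (HalfEdge t k)) ⊆ {d | D.IsTip d} := by
    rintro x (rfl | rfl)
    exacts [h.isTip_left, h.isTip_right]
  have h6 := Set.ncard_sdiff_add_ncard_of_subset h5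
  rw [Set.ncard_pair h.ne] at h6
  have h7 : ({new 1, new 3} : Set (HalfEdge t (k + 1))).ncard ≤ 2 := (Set.ncard_insert_le _ _).trans (by simp)
  omega

end IsMove

/-- The bookkeeping of a play with `S` moves that separate a region and `M` moves that do not. -/
structure Tally (D : Drawing t k) (S M : ℕ) : Prop where
  moves : k = S + M
  regions : 1 + S ≤ finrank ℚ D.regionFun
  comps : n ≤ finrank ℚ D.compFun + M
  joined : ∀ f ∈ D.regionFun, f ∈ D.compFun → ∀ x y, f x = f y
  boundaries : ∃ T : Finset (HalfEdge t k), (∀ x ∈ T, D.IsTip x) ∧ T.card + M ≤ n + S ∧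
    ∀ d, ∃ x ∈ T, D.SameBoundary d x
  tips : {d | D.IsTip d}.ncard ≤ ∑ i, t i

theorem Tally.start (hn : 0 < n) (ht : ∀ i, 0 < t i) : (Drawing.start t).Tally 0 0 where
  moves := rfl
  regions := by
    let L : ℚ →ₗ[ℚ] (Drawing.start t).regionFun :=
      { toFun := fun c => ⟨fun _ => c, fun _ _ _ => rfl⟩
        map_add' := by intro p q; rfl
        map_smul' := by intro c p; rfl }
    have := LinearMap.finrank_le_finrank_of_injective (f := L) fun x y h =>
      congrFun (congrArg Subtype.val h) (Sum.inl ⟨⟨0, hn⟩, ⟨0, ht _⟩⟩)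
    simpa using this
  comps := by
    let L : (Fin n → ℚ) →ₗ[ℚ] (Drawing.start t).compFun :=
      { toFun := fun c => ⟨fun d => Sum.elim c (fun _ => 0) d.vertex, fun d => by
          refine ⟨by simp, rfl⟩⟩
        map_add' := by intro p q; ext d; rcases d with d | d <;> simp [HalfEdge.vertex]
        map_smul' := by intro c p; ext d; rcases d with d | d <;> simp [HalfEdge.vertex] }
    have := LinearMap.finrank_le_finrank_of_injective (f := L) fun x y h => funext fun i =>
      congrFun (congrArg Subtype.val h) (Sum.inl ⟨i, ⟨0, ht _⟩⟩)
    simpa using this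
  joined f hf _ x y := hf x y trivial
  boundaries := by
    classical
    refine ⟨Finset.univ.image fun i : Fin n => .inl ⟨i, ⟨0, ht i⟩⟩, fun x _ => rfl, ?_, ?_⟩
    · simpa using Finset.card_image_le (s := (Finset.univ : Finset (Fin n)))
    · rintro (⟨i, p⟩ | ⟨j, s⟩)
      · exact ⟨_, Finset.mem_image_of_mem _ (Finset.mem_univ i), exists_rot_iterate rfl⟩
      · exact j.elim0
  tips := by
    refine (Set.ncard_le_card _).trans ?_
    simp

theorem Tally.move_of_sameBoundary {S M : ℕ} (hD : D.Tally S M) (h : D.IsMove a b D')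
    (hab : D.SameBoundary a b) : D'.Tally (S + 1) M where
  moves := by have := hD.moves; omega
  regions := by
    have h1 := h.finrank_regionFun_le_of_not_region (h.separates_iff.2 hab)
    have h2 := hD.regions
    omega
  comps := by
    have h1 := h.finrank_compFun_le fun g hg => compFun_sameBoundary hg hab
    have h2 := hD.comps
    omega
  joined := h.joined hD.joined
  boundaries := by
    obtain ⟨T, h1, h2, h3⟩ := hD.boundaries
    obtain ⟨T', h4, h5, h6⟩ := h.exists_transversal_of_sameBoundary hab h1 h3
    exact ⟨T', h4, by omega, h6⟩
  tips := h.ncard_isTip_le.trans hD.tips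

theorem Tally.move_of_not_sameBoundary {S M : ℕ} (hD : D.Tally S M) (h : D.IsMove a b D')
    (hab : ¬ D.SameBoundary a b) : D'.Tally S (M + 1) where
  moves := by have := hD.moves; omega
  regions := hD.regions.trans h.finrank_regionFun_le
  comps := by
    have h1 := h.finrank_compFun_le_succ
    have h2 := hD.comps
    omega
  joined := h.joined hD.joined
  boundaries := by
    obtain ⟨T, h1, h2, h3⟩ := hD.boundaries
    obtain ⟨T', h4, h5, h6⟩ := h.exists_transversal_of_not_sameBoundary hab h1 h3
    exact ⟨T', h4, by omega, h6⟩
  tips := h.ncard_isTip_le.trans hD.tips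

/-- `1 + S ≤ T.card ≤ n + S - M` bounds `M`, and `1 + S ≤ T.card ≤ ∑ i, t i` bounds `S`, because `T`
consists of open tips. -/
theorem Tally.le {S M : ℕ} (hD : D.Tally S M) (hn : 2 ≤ n) : k ≤ (n - 2) + ∑ i, t i := by
  obtain ⟨T, h1, h2, h3⟩ := hD.boundaries
  have h4 := finrank_regionFun_le T h3
  have h5 : T.card ≤ {d | D.IsTip d}.ncard := by
    rw [← Set.ncard_coe_finset]
    exact Set.ncard_le_ncard h1 (Set.toFinite _)
  have := hD.moves
  have := hD.regions
  have := hD.tips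
  omega

/-- A region has at most one boundary component in each connected component of the drawing, as far
as open tips can tell. -/
theorem Tally.exists_compFun_ne {S M : ℕ} (hD : D.Tally S M) (ha : D.IsTip a) (hb : D.IsTip b)
    (hr : D.region a b) (hab : ¬ D.SameBoundary a b) : ∃ g ∈ D.compFun, g a ≠ g b := by
  by_contra! hg
  have hne : a ≠ b := by rintro rfl; exact hab (.refl ..)
  -- Were `a` and `b` not told apart by components, the merging move between them would lose a
  -- boundary component but no region and no component, against the Euler inequality for `D'`.
  obtain ⟨D', h⟩ := exists_isMove ha hb hne hr
  have hD' := hD.move_of_not_sameBoundary h hab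
  obtain ⟨T, -, h2, h3⟩ := hD'.boundaries
  have : Nonempty (HalfEdge t (k + 1)) := ⟨new 0⟩
  have h4 := finrank_regionFun_add_finrank_compFun_le hD'.joined T h3
  have h5 := h.finrank_compFun_le hg
  have h6 := hD.comps
  have h7 := hD'.regions
  omega

end Drawing

end BrusselsSprout

/-! ### Bridges -/

namespace BrusselsSprout

variable {n : ℕ} {t : Fin n → ℕ} {k : ℕ}

open HalfEdge

/-- `X` is closed under rotation, and the only half-edges through which one leaves or enters it
along the pairing `m` are `d` and `m d`. -/
structure Separates (m : HalfEdge t k → HalfEdge t k) (d : HalfEdge t k)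
    (X : Set (HalfEdge t k)) : Prop where
  rot_mem : ∀ x, x.rot ∈ X ↔ x ∈ X
  mate_mem : ∀ x, x ≠ d → x ≠ m d → (m x ∈ X ↔ x ∈ X)
  mem : d ∈ X
  mate_notMem : m d ∉ X

theorem Separates.compl {m : HalfEdge t k → HalfEdge t k} (hm : ∀ x, m (m x) = x)
    {d : HalfEdge t k} {X : Set (HalfEdge t k)} (h : Separates m d X) :
    Separates m (m d) Xᶜ where
  rot_mem x := not_congr (h.rot_mem x)
  mate_mem x hx hx' := not_congr (h.mate_mem x (by rwa [hm] at hx') hx)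
  mem := h.mate_notMem
  mate_notMem := by rw [hm]; exact fun h' => h' h.mem

/-- The orbit can enter `X` only from `y`. If the shortest path from `f y` to `a` left `X`, it would
have to return through `y`, and its remainder from `f y` would be shorter. -/
theorem exists_iterate_mem {α : Type*} {f : α → α} {X : Set α} {y a : α}
    (hX : ∀ x, x ∉ X → f x ∈ X → x = y) {m : ℕ} (hm : f^[m] (f y) = a) (ha : a ∈ X) :
    ∃ i, f^[i] (f y) = a ∧ ∀ j < i, f^[j] (f y) ∈ X ∧ f^[j] (f y) ≠ a := by
  classical
  have hex : ∃ m, f^[m] (f y) = a := ⟨m, hm⟩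
  refine ⟨Nat.find hex, Nat.find_spec hex, fun j hj => ⟨?_, Nat.find_min hex hj⟩⟩
  by_contra hjX
  have key : ∀ l, j ≤ l → l ≤ Nat.find hex → f^[l] (f y) ∉ X := by
    intro l hjl
    induction l, hjl using Nat.le_induction with
    | base => exact fun _ => hjX
    | succ l hjl ih =>
      intro hl h
      have h1 : f^[l] (f y) = y := hX _ (ih (by omega)) (by rwa [Function.iterate_succ_apply'] at h)
      refine Nat.find_min hex (m := Nat.find hex - (l + 1)) (by omega) ?_
      have h2 := Nat.find_spec hex
      rwa [show Nat.find hex = (Nat.find hex - (l + 1)) + (l + 1) by omega,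
        Function.iterate_add_apply, Function.iterate_succ_apply', h1] at h2
  exact key _ hj.le le_rfl ((Nat.find_spec hex).symm ▸ ha)

namespace Drawing

variable {D : Drawing t k} {a b : HalfEdge t k} {D' : Drawing t (k + 1)}

theorem IsMove.separates_old (h : D.IsMove a b D') {d : HalfEdge t k} (hd : ¬ D.IsTip d)
    {X : Set (HalfEdge t k)} (hX : Separates D.mate d X) (hab : a ∈ X ↔ b ∈ X) :
    Separates D'.mate d.old (proj a ⁻¹' X) := by
  have hda : d ≠ a := by rintro rfl; exact hd h.isTip_left
  have hdb : d ≠ b := by rintro rfl; exact hd h.isTip_right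
  refine ⟨?_, ?_, by simpa using hX.mem, by simpa [h.mate_old d hda hdb] using hX.mate_notMem⟩
  · intro x
    induction x using cases_old_new with
    | old e => simpa [rot_old] using hX.rot_mem e
    | new s => simp [rot_new]
  · intro x hx hx'
    induction x using cases_old_new with
    | old e =>
      by_cases hea : e = a
      · subst hea; simp [h.mate_left]
      by_cases heb : e = b
      · subst heb; simp [h.mate_right, hab]
      rw [h.mate_old d hda hdb] at hx'
      simpa [h.mate_old e hea heb] using hX.mate_mem e (by simpa using hx) (by simpa using hx')
    | new s =>
      fin_cases s
      · simp [h.mate_new_zero]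
      · simp [show D'.mate (new 1) = new 1 from h.isTip_new_one]
      · simp [h.mate_new_two, hab]
      · simp [show D'.mate (new 3) = new 3 from h.isTip_new_three]

/-- A level set of `g` is a union of components of the old drawing, and the one through `c` is tied
to the rest of the new drawing only by the edge at `c`. -/
theorem IsMove.separates_new (h : D.IsMove a b D') {g : HalfEdge t k → ℚ} (hg : g ∈ D.compFun)
    (hab : g a ≠ g b) {c : HalfEdge t k} (hc : c = a ∨ c = b) :
    Separates D'.mate c.old
      {x | Sum.elim (fun d => g d = g c) (fun _ => False) x.decode} := by
  refine ⟨?_, ?_, by simp, ?_⟩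
  · intro x
    induction x using cases_old_new with
    | old e => simp [rot_old, (hg e).1]
    | new s => simp [rot_new]
  · intro x hx hx'
    induction x using cases_old_new with
    | old e =>
      by_cases hea : e = a
      · subst hea
        rcases hc with rfl | rfl
        · exact absurd rfl hx
        · simpa [h.mate_left] using hab
      by_cases heb : e = b
      · subst heb
        rcases hc with rfl | rfl
        · simpa [h.mate_right] using hab.symm
        · exact absurd rfl hx
      simp [h.mate_old e hea heb, (hg e).2]
    | new s =>
      fin_cases s
      · rcases hc with rfl | rfl
        · exact absurd h.mate_left.symm hx'
        · simpa [h.mate_new_zero] using hab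
      · simp [show D'.mate (new 1) = new 1 from h.isTip_new_one]
      · rcases hc with rfl | rfl
        · simpa [h.mate_new_two] using hab.symm
        · exact absurd h.mate_right.symm hx'
      · simp [show D'.mate (new 3) = new 3 from h.isTip_new_three]
  · rcases hc with rfl | rfl
    · simp [h.mate_left]
    · simp [h.mate_right]

/-- Every edge with the same boundary component on both sides is a bridge. -/
def BridgeProperty (D : Drawing t k) : Prop :=
  ∀ d, ¬ D.IsTip d → D.SameBoundary d (D.mate d) → ∃ X, Separates D.mate d X

theorem eq_mate_of_next_mem {d : HalfEdge t k} {X : Set (HalfEdge t k)}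
    (hX : Separates D.mate d X) {x : HalfEdge t k} (hx : x ∉ X) (hx' : D.next x ∈ X) :
    x = D.mate d := by
  by_contra hne
  have hxd : x ≠ d := by rintro rfl; exact hx hX.mem
  exact hx ((hX.mate_mem x hxd hne).1 ((hX.rot_mem _).1 hx'))

/-- From `D.mate d` the walk enters `X` and stays there until it reaches `c`. It thus avoids `c'`,
is not altered by the move, and remains in one region. -/
theorem IsMove.region_mate_old {c c' d : HalfEdge t k}
    (hnext : ∀ x, x ≠ c → x ≠ c' → D'.next x.old = (D.next x).old) {X : Set (HalfEdge t k)}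
    (hX : Separates D.mate d X) (hdc : D.SameBoundary (D.mate d) c) (hc : c ∈ X) (hc' : c' ∉ X)
    (hdc' : D.mate d ≠ c') : D'.region (D.mate d).old c.old := by
  obtain ⟨m, hm⟩ := (SameBoundary.next D (D.mate d)).symm.trans hdc
  obtain ⟨i, hi, hj⟩ := exists_iterate_mem (fun x => eq_mate_of_next_mem hX) hm hc
  have hstep : ∀ x, x ≠ c → x ≠ c' → D'.region x.old (D.next x).old := by
    intro x h1 h2
    have := (SameBoundary.next D' x.old).region
    rwa [hnext x h1 h2] at this
  have key : ∀ j ≤ i, D'.region (D.mate d).old (D.next^[j] (D.next (D.mate d))).old := by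
    intro j
    induction j with
    | zero => exact fun _ => hstep _ (fun h => hX.mate_notMem (h ▸ hc)) hdc'
    | succ j ih =>
      intro hji
      rw [Function.iterate_succ_apply']
      exact D'.region.trans (ih (by omega))
        (hstep _ (hj j hji).2 (fun h => hc' (h ▸ (hj j hji).1)))
  exact hi ▸ key i le_rfl

/-- If the bridge had `a` on one side and `b` on the other, the walks from its two ends, each within
its own side, would put one end in the region of `a` and the other in that of `b`. These regions
differ after a separating move, whereas `hdd'` says that the ends share theirs. -/
theorem IsMove.mem_iff_mem_of_sameBoundary (h : D.IsMove a b D') (hab : D.SameBoundary a b)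
    {d : HalfEdge t k} (hd : ¬ D.IsTip d) (hdd : D.SameBoundary d (D.mate d))
    (hdd' : D'.region d.old (D.mate d).old) {X : Set (HalfEdge t k)}
    (hX : Separates D.mate d X) : a ∈ X ↔ b ∈ X := by
  by_cases hda : D.SameBoundary d a
  · have hs := h.separates_iff.2 hab
    have hab' : ¬ D'.region a.old b.old := fun h' => hs
      (D'.region.trans (D'.region.symm h.region_left) (D'.region.trans h' h.region_right))
    have hXc := hX.compl D.mate_mate
    have hd' : ¬ D.IsTip (D.mate d) := by rwa [isTip_mate]
    have hn1 : ∀ x, x ≠ a → x ≠ b → D'.next x.old = (D.next x).old := fun x => h.next_old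
    have hn2 : ∀ x, x ≠ b → x ≠ a → D'.next x.old = (D.next x).old := fun x h1 h2 =>
      h.next_old h2 h1
    have hne : ∀ x, ¬ D.IsTip x → x ≠ a ∧ x ≠ b := by
      refine fun x hx => ⟨?_, ?_⟩
      · rintro rfl; exact hx h.isTip_left
      · rintro rfl; exact hx h.isTip_right
    have hmm : D.mate (D.mate d) = d := D.mate_mate d
    constructor
    · intro ha
      by_contra hb
      have h1 := region_mate_old hn1 hX (hdd.symm.trans hda) ha hb (hne _ hd').2
      have h2 := region_mate_old hn2 hXc (by rw [hmm]; exact hda.trans hab) hb (fun h => h ha)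
        (by rw [hmm]; exact (hne _ hd).1)
      rw [hmm] at h2
      exact hab' (D'.region.trans (D'.region.symm h1) (D'.region.trans (D'.region.symm hdd') h2))
    · intro hb
      by_contra ha
      have h1 := region_mate_old hn2 hX (hdd.symm.trans (hda.trans hab)) hb ha (hne _ hd').1
      have h2 := region_mate_old hn1 hXc (by rw [hmm]; exact hda) ha (fun h => h hb)
        (by rw [hmm]; exact (hne _ hd).2)
      rw [hmm] at h2
      exact hab' (D'.region.trans (D'.region.symm h2) (D'.region.trans hdd' h1))
  -- The boundary through `a` and `b` avoids both halves of the bridge, so it never changes side.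
  · obtain ⟨m, rfl⟩ := hab
    suffices ∀ m, a ∈ X ↔ D.next^[m] a ∈ X from this m
    intro m
    induction m with
    | zero => rfl
    | succ m ih =>
      rw [ih, Function.iterate_succ_apply', Drawing.next, hX.rot_mem, hX.mate_mem]
      · intro h'; exact hda (SameBoundary.symm ⟨m, h'⟩)
      · intro h'; exact hda (hdd.trans (SameBoundary.symm ⟨m, h'⟩))

theorem IsMove.sameBoundary_of_old (h : D.IsMove a b D') {d e : HalfEdge t k}
    (hde : D'.SameBoundary d.old e.old) :
    D.SameBoundary d e ∨ (D.SameBoundary a d ∨ D.SameBoundary b d) ∧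
      (D.SameBoundary a e ∨ D.SameBoundary b e) := by
  have := hde.of_setoid (r := fun x y => D.SameBoundary (proj a x) (proj a y) ∨
    (D.SameBoundary a (proj a x) ∨ D.SameBoundary b (proj a x)) ∧
      (D.SameBoundary a (proj a y) ∨ D.SameBoundary b (proj a y))) ⟨?_, ?_, ?_⟩ ?_
  · simpa using this
  · exact fun x => .inl (.refl ..)
  · exact fun h' => h'.imp SameBoundary.symm And.symm
  · rintro x y z (h1 | h1) (h2 | h2)
    · exact .inl (h1.trans h2)
    · exact .inr ⟨h2.1.imp (·.trans h1.symm) (·.trans h1.symm), h2.2⟩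
    · exact .inr ⟨h1.1, h1.2.imp (·.trans h2) (·.trans h2)⟩
    · exact .inr ⟨h1.1, h2.2⟩
  · intro x
    induction x using cases_old_new with
    | old d =>
      by_cases ha : d = a
      · subst ha; rw [h.next_left]; simpa using .inl (.refl ..)
      by_cases hb : d = b
      · subst hb; rw [h.next_right]
        simpa using .inr ⟨.inr (.refl ..), .inl (.refl ..)⟩
      rw [h.next_old ha hb]
      simpa using .inl (.next ..)
    | new s =>
      fin_cases s
      · simpa [h.next_new_zero] using .inl (.next ..)
      · simpa [h.next_new_one] using .inl (.refl ..)
      · simpa [h.next_new_two] using .inr ⟨.inl (.refl ..), .inr (.next ..)⟩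
      · simpa [h.next_new_three] using .inl (.refl ..)

/-- Halves of the new curve have one boundary on both sides only after a merging move, and are then
bridges because the move joins different components. For an old edge, the old bridge is used, with
sides adjusted so that `a` and `b` are on the same one. -/
theorem IsMove.bridgeProperty (h : D.IsMove a b D') (hD : D.BridgeProperty)
    (hcomp : ¬ D.SameBoundary a b → ∃ g ∈ D.compFun, g a ≠ g b) : D'.BridgeProperty := by
  have hnew : ∀ c s, c = a ∨ c = b → D'.mate c.old = new s → D'.SameBoundary c.old (new s) →
      ∃ X, Separates D'.mate c.old X ∧ Separates D'.mate (new s) Xᶜ := by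
    intro c s hc hs hcs
    have hab : ¬ D.SameBoundary a b := by
      intro hab
      refine h.separates_iff.2 hab ?_
      rcases hc with rfl | rfl
      · obtain rfl : 0 = s := new_inj.1 (h.mate_left.symm.trans hs)
        exact D'.region.trans (D'.region.symm h.region_left)
          (D'.region.trans hcs.region (D'.region.symm h.region_three_zero))
      · obtain rfl : 2 = s := new_inj.1 (h.mate_right.symm.trans hs)
        exact D'.region.symm (D'.region.trans (D'.region.symm h.region_right)
          (D'.region.trans hcs.region (D'.region.symm h.region_one_two)))
    obtain ⟨g, hg, hgab⟩ := hcomp hab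
    have := h.separates_new hg hgab hc
    exact ⟨_, this, hs ▸ this.compl D'.mate_mate⟩
  intro x hx hxx
  induction x using cases_old_new with
  | new s =>
    rw [h.isTip_new] at hx
    fin_cases s
    · obtain ⟨X, -, hX⟩ := hnew a 0 (.inl rfl) h.mate_left (h.mate_new_zero ▸ hxx.symm)
      exact ⟨_, hX⟩
    · simp at hx
    · obtain ⟨X, -, hX⟩ := hnew b 2 (.inr rfl) h.mate_right (h.mate_new_two ▸ hxx.symm)
      exact ⟨_, hX⟩
    · simp at hx
  | old d =>
    by_cases hda : d = a
    · subst hda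
      obtain ⟨X, hX, -⟩ := hnew d 0 (.inl rfl) h.mate_left (h.mate_left ▸ hxx)
      exact ⟨_, hX⟩
    by_cases hdb : d = b
    · subst hdb
      obtain ⟨X, hX, -⟩ := hnew d 2 (.inr rfl) h.mate_right (h.mate_right ▸ hxx)
      exact ⟨_, hX⟩
    have hd : ¬ D.IsTip d := fun h' => hx (h.isTip_old.2 ⟨h', hda, hdb⟩)
    rw [h.mate_old d hda hdb] at hxx
    by_cases hab : D.SameBoundary a b
    · have hdd : D.SameBoundary d (D.mate d) := by
        rcases h.sameBoundary_of_old hxx with h1 | ⟨h1, h2⟩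
        · exact h1
        · have h1 : D.SameBoundary a d := h1.elim id hab.trans
          have h2 : D.SameBoundary a (D.mate d) := h2.elim id hab.trans
          exact h1.symm.trans h2
      obtain ⟨X, hX⟩ := hD d hd hdd
      exact ⟨_, h.separates_old hd hX
        (h.mem_iff_mem_of_sameBoundary hab hd hdd hxx.region hX)⟩
    · obtain ⟨g, hg, hgab⟩ := hcomp hab
      have hgd := (hg d).2
      have hdd : D.SameBoundary d (D.mate d) := by
        rcases h.sameBoundary_of_old hxx with h1 | ⟨h1 | h1, h2 | h2⟩
        · exact h1
        · exact h1.symm.trans h2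
        · rw [← compFun_sameBoundary hg h1, ← compFun_sameBoundary hg h2] at hgd
          exact absurd hgd.symm hgab
        · rw [← compFun_sameBoundary hg h1, ← compFun_sameBoundary hg h2] at hgd
          exact absurd hgd hgab
        · exact h1.symm.trans h2
      obtain ⟨X, hX⟩ := hD d hd hdd
      -- `c` is an end of the curve whose `g`-level does not contain the bridge; this whole level
      -- can be moved to the side of `c'`.
      obtain ⟨c, c', hc, hcd, hcc⟩ : ∃ c c', (c = a ∧ c' = b ∨ c = b ∧ c' = a) ∧ g d ≠ g c ∧
          g c' ≠ g c := by
        by_cases hda : g d = g a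
        · exact ⟨b, a, .inr ⟨rfl, rfl⟩, hda ▸ hgab, hgab⟩
        · exact ⟨a, b, .inl ⟨rfl, rfl⟩, hda, hgab.symm⟩
      have hY : Separates D.mate d {x | g x = g c ∧ c' ∈ X ∨ g x ≠ g c ∧ x ∈ X} := by
        refine ⟨?_, ?_, ?_, ?_⟩
        · intro x
          simp only [Set.mem_ofPred_eq, (hg x).1, hX.rot_mem]
        · intro x h1 h2
          simp only [Set.mem_ofPred_eq, (hg x).2, hX.mate_mem x h1 h2]
        · exact .inr ⟨hcd, hX.mem⟩
        · rintro (h' | h')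
          · exact hcd (hgd.symm.trans h'.1)
          · exact hX.mate_notMem h'.2
      refine ⟨_, h.separates_old hd hY ?_⟩
      rcases hc with ⟨rfl, rfl⟩ | ⟨rfl, rfl⟩ <;> simp [hcc]

end Drawing

end BrusselsSprout

/-! ### Age of vertices, cutting a bridge, closed sets -/

namespace BrusselsSprout

variable {n : ℕ} {t : Fin n → ℕ} {k : ℕ}

namespace HalfEdge

/-- The time at which the vertex of a half-edge was drawn; `0` for the initial spots. -/
def time (d : HalfEdge t k) : ℕ := Sum.elim (fun _ => 0) (fun d => d.1.val + 1) d

/-- The half-edge is one of the two halves of the curve on which its vertex was drawn. -/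
def IsDown (d : HalfEdge t k) : Prop := Sum.elim (fun _ => False) (fun d => d.2 = 0 ∨ d.2 = 2) d

theorem time_eq_of_vertex {x y : HalfEdge t k} (h : x.vertex = y.vertex) : x.time = y.time := by
  rcases x with ⟨i, p⟩ | ⟨j, s⟩ <;> rcases y with ⟨i', q⟩ | ⟨j', s'⟩
  · rfl
  · cases h
  · cases h
  · cases h; rfl

theorem time_le (x : HalfEdge t k) : x.time ≤ k := by
  rcases x with ⟨i, p⟩ | ⟨j, s⟩
  · exact Nat.zero_le _
  · exact j.2

@[simp] theorem time_rot (x : HalfEdge t k) : x.rot.time = x.time :=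
  time_eq_of_vertex (vertex_rot x)

theorem IsDown.time_ne {x : HalfEdge t k} (h : x.IsDown) : x.time ≠ 0 := by
  rcases x with ⟨i, p⟩ | ⟨j, s⟩
  · exact h.elim
  · exact Nat.succ_ne_zero _

theorem isDown_rot {x : HalfEdge t k} (h : x.time ≠ 0) : x.rot.IsDown ↔ ¬ x.IsDown := by
  rcases x with ⟨i, p⟩ | ⟨j, s⟩
  · exact absurd rfl h
  · show (s + 1 = 0 ∨ s + 1 = 2) ↔ ¬ (s = 0 ∨ s = 2)
    clear h; revert s; decide

theorem rot_rot_rot_rot {x : HalfEdge t k} (h : x.time ≠ 0) : x.rot.rot.rot.rot = x := by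
  rcases x with ⟨i, p⟩ | ⟨j, s⟩
  · exact absurd rfl h
  · show (Sum.inr (j, s + 1 + 1 + 1 + 1) : HalfEdge t k) = Sum.inr (j, s)
    congr 2
    clear h; revert s; decide

theorem rot_rot_ne {x : HalfEdge t k} (h : x.time ≠ 0) : x.rot.rot ≠ x := by
  rcases x with ⟨i, p⟩ | ⟨j, s⟩
  · exact absurd rfl h
  · intro h'
    have : s + 1 + 1 = s := (Prod.ext_iff.1 (Sum.inr.inj h')).2
    clear h h'; revert s; decide

theorem eq_of_vertex_of_isDown_iff {x y : HalfEdge t k} (h : x.time ≠ 0)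
    (hxy : x.vertex = y.vertex) (hd : x.IsDown ↔ y.IsDown) : y = x ∨ y = x.rot.rot := by
  rcases x with ⟨i, p⟩ | ⟨j, s⟩
  · exact absurd rfl h
  rcases y with ⟨i, p⟩ | ⟨j', s'⟩
  · cases hxy
  cases hxy
  have : ∀ s s' : Fin 4, ((s = 0 ∨ s = 2) ↔ (s' = 0 ∨ s' = 2)) → s' = s ∨ s' = s + 1 + 1 := by
    decide
  rcases this s s' hd with rfl | rfl
  exacts [.inl rfl, .inr rfl]

theorem eq_rot_of_vertex_of_isDown_iff {x y : HalfEdge t k} (h : x.time ≠ 0)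
    (hxy : x.vertex = y.vertex) (hd : x.IsDown ↔ ¬ y.IsDown) : y = x.rot ∨ x = y.rot := by
  rcases eq_of_vertex_of_isDown_iff (x := x.rot) (y := y) (by simpa) (by simpa)
    (by rw [isDown_rot h]; tauto) with h1 | h1
  · exact .inl h1
  · exact .inr (by rw [h1, rot_rot_rot_rot h])

theorem rot_ne_of_time {x : HalfEdge t k} (ht : ∀ i, 3 ≤ t i) (h : x.time = 0) : x.rot ≠ x := by
  rcases x with ⟨i, p⟩ | ⟨j, s⟩
  · intro h'
    have h1 : finRotate (t i) p = p := by simpa [rot] using h'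
    have := ht i
    obtain ⟨N, hN⟩ : ∃ N, t i = N + 2 := ⟨t i - 2, by omega⟩
    clear h h'
    revert p
    rw [hN]
    intro p h1
    rw [finRotate_apply] at h1
    simp at h1
  · simp [time] at h

end HalfEdge

open HalfEdge

namespace Drawing

variable {D : Drawing t k} {a b : HalfEdge t k} {D' : Drawing t (k + 1)}

/-- Each edge joins a half of the curve of a crossbar to an older vertex. -/
structure Timed (D : Drawing t k) : Prop where
  isDown_mate : ∀ d, ¬ D.IsTip d → ((D.mate d).IsDown ↔ ¬ d.IsDown)
  time_mate_lt : ∀ d, d.IsDown → ¬ D.IsTip d → (D.mate d).time < d.time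

/-- Halves of curves are never open tips, so the new vertex, which is the youngest, is attached only
to half-edges that are not down. -/
theorem IsMove.timed (h : D.IsMove a b D') (hD : D.Timed) (hd : ∀ d, d.IsDown → ¬ D.IsTip d) :
    D'.Timed ∧ ∀ d, d.IsDown → ¬ D'.IsTip d := by
  have hold : ∀ d : HalfEdge t k, d.old.IsDown ↔ d.IsDown := by
    rintro (d | ⟨j, s⟩) <;> rfl
  have htime : ∀ d : HalfEdge t k, d.old.time = d.time := by
    rintro (d | ⟨j, s⟩) <;> rfl
  have hnew : ∀ s, (new s : HalfEdge t (k + 1)).IsDown ↔ s = 0 ∨ s = 2 := fun s => Iff.rfl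
  have hnewt : ∀ s, (new s : HalfEdge t (k + 1)).time = k + 1 := fun s => rfl
  have ha : ¬ a.IsDown := fun h' => hd a h' h.isTip_left
  have hb : ¬ b.IsDown := fun h' => hd b h' h.isTip_right
  refine ⟨⟨?_, ?_⟩, ?_⟩
  · intro x hx
    induction x using cases_old_new with
    | old d =>
      rw [h.isTip_old] at hx
      by_cases hda : d = a
      · subst hda; simp [h.mate_left, hold, hnew, ha]
      by_cases hdb : d = b
      · subst hdb; simp [h.mate_right, hold, hnew, hb]
      rw [h.mate_old d hda hdb, hold, hold, hD.isDown_mate d fun h' => hx ⟨h', hda, hdb⟩]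
    | new s =>
      rw [h.isTip_new] at hx
      fin_cases s
      · simp [h.mate_new_zero, hold, hnew, ha]
      · simp at hx
      · simp [h.mate_new_two, hold, hnew, hb]
      · simp at hx
  · intro x hx hx'
    induction x using cases_old_new with
    | old d =>
      rw [hold] at hx
      have hda : d ≠ a := by rintro rfl; exact ha hx
      have hdb : d ≠ b := by rintro rfl; exact hb hx
      rw [h.mate_old d hda hdb, htime, htime]
      exact hD.time_mate_lt d hx (hd d hx)
    | new s =>
      rw [h.isTip_new] at hx'
      have := time_le a
      have := time_le b
      fin_cases s
      · simp only [Fin.zero_eta, h.mate_new_zero, htime, hnewt]; omega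
      · simp at hx'
      · simp only [Fin.reduceFinMk, h.mate_new_two, htime, hnewt]; omega
      · simp at hx'
  · intro x hx hx'
    induction x using cases_old_new with
    | old d => exact hd d ((hold d).1 hx) (h.isTip_old.1 hx').1
    | new s =>
      rw [h.isTip_new] at hx'
      rw [hnew] at hx
      rcases hx with rfl | rfl <;> simp at hx'

/-- Cut the edge containing `u` into two open tips, forgetting the regions. -/
def cut (D : Drawing t k) (u : HalfEdge t k) : Drawing t k :=
  open scoped Classical in
  { mate := fun x => if x = u ∨ x = D.mate u then x else D.mate x
    mate_mate := by
      intro x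
      by_cases h : x = u ∨ x = D.mate u
      · simp [h]
      · have h' : ¬ (D.mate x = u ∨ D.mate x = D.mate u) := by
          rintro (h1 | h1)
          · exact h (.inr (by rw [← h1, D.mate_mate]))
          · exact h (.inl (by rw [← D.mate_mate x, h1, D.mate_mate]))
        rw [if_neg h, if_neg h', D.mate_mate]
    region := ⊤
    region_rot_mate := fun _ => trivial }

theorem cut_mate_of_ne {u x : HalfEdge t k} (h : x ≠ u) (h' : x ≠ D.mate u) :
    (D.cut u).mate x = D.mate x := if_neg (by simp [h, h'])

theorem isTip_cut {u x : HalfEdge t k} :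
    (D.cut u).IsTip x ↔ D.IsTip x ∨ x = u ∨ x = D.mate u := by
  by_cases h : x = u ∨ x = D.mate u
  · exact iff_of_true (if_pos h) (.inr h)
  · rw [not_or] at h
    simp [IsTip, cut_mate_of_ne h.1 h.2, h]

theorem sameBoundary_of_cut {u : HalfEdge t k} (hu : D.SameBoundary u (D.mate u))
    {x y : HalfEdge t k} (h : (D.cut u).SameBoundary x y) : D.SameBoundary x y := by
  refine h.of_setoid (r := D.SameBoundary) ⟨.refl D, .symm, .trans⟩ fun x => ?_
  by_cases h1 : x = u
  · subst h1
    rw [Drawing.next, show (D.cut x).mate x = x from isTip_cut.2 (.inr (.inl rfl))]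
    refine hu.trans ⟨1, ?_⟩
    rw [Function.iterate_one, Drawing.next, D.mate_mate]
  by_cases h2 : x = D.mate u
  · subst h2
    rw [Drawing.next, show (D.cut u).mate (D.mate u) = D.mate u from isTip_cut.2 (.inr (.inr rfl))]
    exact hu.symm.trans (.next ..)
  rw [Drawing.next, cut_mate_of_ne h1 h2]
  exact .next ..

/-- An excursion out of `Y` leaves through `u` and comes back through `D.mate u`. After the cut it
is replaced by the turn round the open tip `u`. -/
theorem sameBoundary_cut {u : HalfEdge t k} {Y : Set (HalfEdge t k)}
    (hY : Separates D.mate u Y) {x y : HalfEdge t k} (hx : x ∈ Y) (hy : y ∈ Y)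
    (h : D.SameBoundary x y) : (D.cut u).SameBoundary x y := by
  obtain ⟨m, rfl⟩ := h
  suffices (D.next^[m] x ∈ Y → (D.cut u).SameBoundary x (D.next^[m] x)) ∧
      (D.next^[m] x ∉ Y → (D.cut u).SameBoundary x u) from this.1 hy
  clear hy
  induction m with
  | zero => exact ⟨fun _ => .refl .., fun h => absurd hx h⟩
  | succ m ih =>
    rw [Function.iterate_succ_apply']
    set z := D.next^[m] x
    by_cases hz : z ∈ Y
    · have hzm : z ≠ D.mate u := fun h => hY.mate_notMem (h ▸ hz)
      by_cases hzu : z = u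
      · have : D.next z ∉ Y := by
          rw [hzu, Drawing.next, hY.rot_mem]; exact hY.mate_notMem
        exact ⟨fun h => absurd h this, fun _ => hzu ▸ ih.1 hz⟩
      · have h1 : D.next z ∈ Y := (hY.rot_mem _).2 ((hY.mate_mem z hzu hzm).2 hz)
        refine ⟨fun _ => (ih.1 hz).trans ⟨1, ?_⟩, fun h => absurd h1 h⟩
        rw [Function.iterate_one, Drawing.next, cut_mate_of_ne hzu hzm]; rfl
    · refine ⟨fun h => ?_, fun _ => ih.2 hz⟩
      have h1 := eq_mate_of_next_mem hY hz h
      refine (ih.2 hz).trans ⟨1, ?_⟩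
      rw [Function.iterate_one, Drawing.next,
        show (D.cut u).mate u = u from isTip_cut.2 (.inr (.inl rfl)), h1, Drawing.next, D.mate_mate]

theorem Adj.of_cut {u : HalfEdge t k} {x y : Vertex n k} (h : (D.cut u).Adj x y) : D.Adj x y := by
  obtain ⟨d, hd, h1, h2⟩ := h
  rw [isTip_cut, not_or, not_or] at hd
  rw [cut_mate_of_ne hd.2.1 hd.2.2] at h2
  exact ⟨d, hd.1, h1, h2⟩

/-- `X` is a union of connected components of the drawing, in which no move is possible. -/
structure Closed (D : Drawing t k) (X : Set (HalfEdge t k)) : Prop where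
  sparse : D.Sparse
  timed : D.Timed
  bridge : D.BridgeProperty
  rot_mem : ∀ x ∈ X, x.rot ∈ X
  mate_mem : ∀ x ∈ X, D.mate x ∈ X
  isDown_not_isTip : ∀ x ∈ X, x.IsDown → ¬ D.IsTip x
  exists_spot_edge : ∀ x : HalfEdge t k, x.time = 0 → ∃ y, y.vertex = x.vertex ∧ ¬ D.IsTip y
  tips : ∀ x ∈ X, ∀ y ∈ X, D.IsTip x → D.IsTip y → D.SameBoundary x y →
    x.vertex = y.vertex ∨ D.Adj x.vertex y.vertex
  exists_crossbar : ∃ x ∈ X, HalfEdge.time x ≠ 0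

theorem _root_.BrusselsSprout.Separates.mem_iff_of_vertex {m : HalfEdge t k → HalfEdge t k}
    {d : HalfEdge t k} {Y : Set (HalfEdge t k)} (hY : Separates m d Y) {x y : HalfEdge t k}
    (h : x.vertex = y.vertex) : x ∈ Y ↔ y ∈ Y := by
  obtain ⟨l, rfl⟩ := exists_rot_iterate h
  clear h
  induction l with
  | zero => rfl
  | succ l ih => rw [Function.iterate_succ_apply', hY.rot_mem, ih]

namespace Closed

variable {X : Set (HalfEdge t k)}

theorem mem_of_vertex (h : D.Closed X) {x y : HalfEdge t k} (hx : x ∈ X)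
    (hxy : x.vertex = y.vertex) : y ∈ X := by
  obtain ⟨l, rfl⟩ := exists_rot_iterate hxy
  clear hxy
  induction l with
  | zero => exact hx
  | succ l ih => rw [Function.iterate_succ_apply']; exact h.rot_mem _ ih

theorem next_mem (h : D.Closed X) {x : HalfEdge t k} (hx : x ∈ X) : D.next x ∈ X :=
  h.rot_mem _ (h.mate_mem _ hx)

theorem mem_of_sameBoundary (h : D.Closed X) {x y : HalfEdge t k} (hx : x ∈ X)
    (hxy : D.SameBoundary x y) : y ∈ X := by
  obtain ⟨m, rfl⟩ := hxy
  induction m with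
  | zero => exact hx
  | succ m ih => rw [Function.iterate_succ_apply']; exact h.next_mem ih

/-- The part of `X` on one side of a bridge, after cutting the bridge. -/
theorem cut (h : D.Closed X) {u : HalfEdge t k} (hu : u ∈ X) (hud : ¬ u.IsDown)
    (hut : u.time ≠ 0) (hutip : ¬ D.IsTip u) (huu : D.SameBoundary u (D.mate u))
    {Y : Set (HalfEdge t k)} (hY : Separates D.mate u Y)
    (htips : ∀ x ∈ X, x ∈ Y → D.IsTip x → D.SameBoundary u x → x.vertex = u.vertex) :
    (D.cut u).Closed (X ∩ Y) where
  sparse := by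
    refine ⟨fun x hx => h.sparse.not_adj_self x hx.of_cut, ?_,
      fun x y z h1 h2 h3 => h.sparse.no_triangle x y z h1.of_cut h2.of_cut h3.of_cut⟩
    intro d e hd he hv hm
    rw [isTip_cut, not_or, not_or] at hd he
    rw [cut_mate_of_ne hd.2.1 hd.2.2, cut_mate_of_ne he.2.1 he.2.2] at hm
    exact h.sparse.eq_of_vertex d e hd.1 he.1 hv hm
  timed := by
    constructor
    · intro d hd
      rw [isTip_cut, not_or, not_or] at hd
      rw [cut_mate_of_ne hd.2.1 hd.2.2]
      exact h.timed.isDown_mate d hd.1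
    · intro d hd' hd
      rw [isTip_cut, not_or, not_or] at hd
      rw [cut_mate_of_ne hd.2.1 hd.2.2]
      exact h.timed.time_mate_lt d hd' hd.1
  bridge := by
    intro d hd hdd
    rw [isTip_cut, not_or, not_or] at hd
    have hdd := sameBoundary_of_cut huu hdd
    rw [cut_mate_of_ne hd.2.1 hd.2.2] at hdd
    obtain ⟨Z, hZ⟩ := h.bridge d hd.1 hdd
    refine ⟨Z, hZ.rot_mem, ?_, hZ.mem, ?_⟩
    · intro x hx hx'
      rw [cut_mate_of_ne hd.2.1 hd.2.2] at hx'
      by_cases hxu : x = u ∨ x = D.mate u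
      · rw [show (D.cut u).mate x = x from isTip_cut.2 (.inr hxu)]
      · rw [not_or] at hxu
        rw [cut_mate_of_ne hxu.1 hxu.2]
        exact hZ.mate_mem x hx hx'
    · rw [cut_mate_of_ne hd.2.1 hd.2.2]
      exact hZ.mate_notMem
  rot_mem x hx := ⟨h.rot_mem x hx.1, (hY.rot_mem x).2 hx.2⟩
  mate_mem x hx := by
    by_cases hxu : x = u ∨ x = D.mate u
    · rw [show (D.cut u).mate x = x from isTip_cut.2 (.inr hxu)]
      exact hx
    · rw [not_or] at hxu
      rw [cut_mate_of_ne hxu.1 hxu.2]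
      exact ⟨h.mate_mem x hx.1, (hY.mate_mem x hxu.1 hxu.2).2 hx.2⟩
  isDown_not_isTip := by
    rintro x ⟨hx, hxY⟩ hxd hxt
    rcases isTip_cut.1 hxt with h1 | rfl | rfl
    exacts [h.isDown_not_isTip x hx hxd h1, hud hxd, hY.mate_notMem hxY]
  exists_spot_edge := by
    intro x hx
    obtain ⟨y, hy, hyt⟩ := h.exists_spot_edge x hx
    have hy0 : y.time = 0 := (time_eq_of_vertex hy).trans hx
    refine ⟨y, hy, fun h' => ?_⟩
    rcases isTip_cut.1 h' with h1 | rfl | rfl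
    · exact hyt h1
    · exact hut hy0
    · exact ((h.timed.isDown_mate u hutip).2 hud).time_ne hy0
  tips := by
    rintro x ⟨hx, hxY⟩ y ⟨hy, hyY⟩ hxt hyt hxy
    have hs := sameBoundary_of_cut huu hxy
    have hx' : D.IsTip x ∨ x = u := by
      rcases isTip_cut.1 hxt with h1 | h1 | rfl
      exacts [.inl h1, .inr h1, absurd hxY hY.mate_notMem]
    have hy' : D.IsTip y ∨ y = u := by
      rcases isTip_cut.1 hyt with h1 | h1 | rfl
      exacts [.inl h1, .inr h1, absurd hyY hY.mate_notMem]
    -- The only new tip in `Y` is `u`, which `htips` takes care of. An edge between two old tips'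
    -- vertices in `Y` has both ends in `Y`, so it is not the bridge and survives.
    rcases hx' with hx' | rfl <;> rcases hy' with hy' | rfl
    · refine (h.tips x hx y hy hx' hy' hs).imp_right ?_
      rintro ⟨d, hd, h1, h2⟩
      have hdY : d ∈ Y := (hY.mem_iff_of_vertex h1).2 hxY
      have hmY : D.mate d ∈ Y := (hY.mem_iff_of_vertex h2).2 hyY
      have hdu : d ≠ u := by rintro rfl; exact hY.mate_notMem hmY
      have hdm : d ≠ D.mate u := by rintro rfl; exact hY.mate_notMem hdY
      exact ⟨d, by rw [isTip_cut]; tauto, h1, by rw [cut_mate_of_ne hdu hdm, h2]⟩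
    · exact .inl (htips x hx hxY hx' hs.symm)
    · exact .inl (htips y hy hyY hy' hs).symm
    · exact .inl rfl
  exists_crossbar := ⟨u, ⟨hu, hY.mem⟩, hut⟩

end Closed

end Drawing

end BrusselsSprout

/-! ### Climbing and descending walks; two peaks on a boundary -/

namespace BrusselsSprout

variable {n : ℕ} {t : Fin n → ℕ} {k : ℕ}

open HalfEdge

namespace Drawing

variable {D : Drawing t k}

/-- An open tip at a crossbar. -/
def IsPeak (D : Drawing t k) (p : HalfEdge t k) : Prop := D.IsTip p ∧ p.time ≠ 0

theorem IsTip.next_eq {x : HalfEdge t k} (hx : D.IsTip x) : D.next x = x.rot := by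
  rw [Drawing.next, hx]

theorem next_mate (x : HalfEdge t k) : D.next (D.mate x) = x.rot := by
  rw [Drawing.next, D.mate_mate]

namespace Closed

variable {X : Set (HalfEdge t k)}

theorem isTip_not_isDown (h : D.Closed X) {x : HalfEdge t k} (hx : x ∈ X) (hxt : D.IsTip x) :
    ¬ x.IsDown := fun h' => h.isDown_not_isTip x hx h' hxt

theorem time_next_of_up (h : D.Closed X) {x : HalfEdge t k} (hxd : ¬ x.IsDown)
    (hxt : ¬ D.IsTip x) : ¬ (D.next x).IsDown ∧ x.time < (D.next x).time := by
  have h1 := (h.timed.isDown_mate x hxt).2 hxd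
  have h2 := h.timed.time_mate_lt _ h1 (by rwa [isTip_mate])
  rw [D.mate_mate] at h2
  refine ⟨?_, by rwa [Drawing.next, time_rot]⟩
  rw [Drawing.next, isDown_rot h1.time_ne, not_not]
  exact h1

/-- Going upwards, the boundary walk arrives at an open tip of a crossbar. -/
theorem exists_peak (h : D.Closed X) {x : HalfEdge t k} (hxd : ¬ x.IsDown)
    (hxt : ¬ D.IsTip x) : ∃ m, D.IsPeak (D.next^[m + 1] x) ∧
      ∀ j ≤ m, x.time < (D.next^[j + 1] x).time := by
  obtain ⟨N, hN⟩ : ∃ N, k - x.time ≤ N := ⟨_, le_rfl⟩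
  induction N generalizing x with
  | zero =>
    have h1 := h.time_next_of_up hxd hxt
    have h2 := time_le (D.next x)
    omega
  | succ N ih =>
    obtain ⟨h1, h2⟩ := h.time_next_of_up hxd hxt
    by_cases h3 : D.IsTip (D.next x)
    · refine ⟨0, ⟨h3, fun h0 => ?_⟩, fun j hj => ?_⟩
      · change (D.next x).time = 0 at h0; omega
      · obtain rfl : j = 0 := by omega
        exact h2
    · obtain ⟨m, hm, hj⟩ := ih h1 h3 (by omega)
      refine ⟨m + 1, hm, fun j hjm => ?_⟩
      rcases j with _ | j
      · exact h2
      · exact h2.trans (hj j (by omega))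

/-- Going downwards, the boundary walk arrives at a spot. -/
theorem exists_spot (h : D.Closed X) {x : HalfEdge t k} (hx : x ∈ X) (hxd : x.IsDown) :
    ∃ y ∈ X, y.IsDown ∧ (D.mate y).time = 0 ∧ D.SameBoundary x y ∧ (y = x ∨ y.time < x.time) := by
  obtain ⟨N, hN⟩ : ∃ N, x.time ≤ N := ⟨_, le_rfl⟩
  induction N generalizing x with
  | zero => exact absurd (by omega) hxd.time_ne
  | succ N ih =>
    have hxt := h.isDown_not_isTip x hx hxd
    by_cases h0 : (D.mate x).time = 0
    · exact ⟨x, hx, hxd, h0, .refl .., .inl rfl⟩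
    · have h1 : (D.next x).time < x.time := by
        rw [Drawing.next, time_rot]; exact h.timed.time_mate_lt x hxd hxt
      have h2 : (D.next x).IsDown := by
        rw [Drawing.next, isDown_rot h0, h.timed.isDown_mate x hxt, not_not]; exact hxd
      obtain ⟨y, hy, hyd, hy0, hxy, hyt⟩ := ih (h.next_mem hx) h2 (by omega)
      refine ⟨y, hy, hyd, hy0, (SameBoundary.next D x).trans hxy, .inr ?_⟩
      rcases hyt with rfl | hyt <;> omega

/-- Rotating about a spot, the boundary walk arrives at an edge. -/
theorem exists_spot_edge_sameBoundary (h : D.Closed X) {x : HalfEdge t k} (hx : x.time = 0) :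
    ∃ y, y.vertex = x.vertex ∧ ¬ D.IsTip y ∧ D.SameBoundary x y := by
  obtain ⟨z, hz, hzt⟩ := h.exists_spot_edge x hx
  obtain ⟨m, rfl⟩ := exists_rot_iterate hz.symm
  induction m generalizing x with
  | zero => exact ⟨x, rfl, hzt, .refl ..⟩
  | succ m ih =>
    by_cases hxt : D.IsTip x
    · obtain ⟨y, h1, h2, h3⟩ := ih (x := x.rot) (by simpa using hx) (by
        rw [← Function.iterate_succ_apply, hz, vertex_rot]) hzt
      refine ⟨y, by rw [h1, vertex_rot], h2, .trans ⟨1, ?_⟩ h3⟩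
      rw [Function.iterate_one, hxt.next_eq]
    · exact ⟨x, rfl, hxt, .refl ..⟩

theorem not_isDown_of_time {x : HalfEdge t k} (hx : x.time = 0) : ¬ x.IsDown := fun h =>
  h.time_ne hx

/-- From a bridge at a spot, the boundary walk meets an open tip on the side of the spot. -/
theorem exists_isTip_of_separates (h : D.Closed X) (ht : ∀ i, 3 ≤ t i) {u : HalfEdge t k}
    (hu : u ∈ X) (hut : u.time = 0) (huu : D.SameBoundary u (D.mate u))
    {Y : Set (HalfEdge t k)} (hY : Separates D.mate u Y) :
    ∃ x ∈ X, x ∈ Y ∧ D.IsTip x ∧ D.SameBoundary u x := by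
  have h1 : D.SameBoundary u u.rot := huu.trans ⟨1, next_mate u⟩
  have hz : u.rot ∈ Y := (hY.rot_mem u).2 hY.mem
  by_cases hzt : D.IsTip u.rot
  · exact ⟨_, h.rot_mem u hu, hz, hzt, h1⟩
  · obtain ⟨m, hm, hj⟩ := h.exists_peak (not_isDown_of_time (by simpa using hut)) hzt
    have h2 : D.SameBoundary u.rot (D.next^[m + 1] u.rot) := ⟨_, rfl⟩
    refine ⟨_, h.mem_of_sameBoundary (h.rot_mem u hu) h2, ?_, hm.1, h1.trans h2⟩
    -- The climb stays in `Y` because it does not pass through `u`: later times are positive, and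
    -- its first half-edge `u.rot` differs from `u` since a spot has at least three half-edges.
    have key : ∀ j ≤ m + 1, D.next^[j] u.rot ∈ Y := by
      intro j
      induction j with
      | zero => exact fun _ => hz
      | succ j ih =>
        intro hjm
        have ih := ih (by omega)
        rw [Function.iterate_succ_apply', Drawing.next, hY.rot_mem, hY.mate_mem]
        · exact ih
        · rcases j with _ | j
          · exact rot_ne_of_time ht hut
          · intro h'
            have := hj j (by omega)
            rw [h'] at this
            omega
        · intro h'
          exact hY.mate_notMem (h' ▸ ih)
    exact key _ le_rfl

theorem vertex_eq_of_adj {u : HalfEdge t k} {Y : Set (HalfEdge t k)}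
    (hY : Separates D.mate u Y) {x c : HalfEdge t k} (hx : x ∈ Y) (hc : c ∉ Y)
    (hxc : D.Adj x.vertex c.vertex) : x.vertex = u.vertex := by
  obtain ⟨y, -, hyx, hyc⟩ := hxc
  have hy : y ∈ Y := (hY.mem_iff_of_vertex hyx).2 hx
  have hm : D.mate y ∉ Y := fun h' => hc ((hY.mem_iff_of_vertex hyc).1 h')
  have : y = u := by
    by_contra hyu
    refine hm ((hY.mate_mem y hyu ?_).2 hy)
    rintro rfl
    exact hY.mate_notMem hy
  rw [← hyx, this]

theorem not_adj_of_time (h : D.Closed X) {x y : HalfEdge t k} (hx : x.time = 0)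
    (hy : y.time = 0) : ¬ D.Adj x.vertex y.vertex := by
  rintro ⟨d, hd, h1, h2⟩
  have h3 := (time_eq_of_vertex h1).trans hx
  have h4 := (time_eq_of_vertex h2).trans hy
  exact ((h.timed.isDown_mate d hd).2 (not_isDown_of_time h3)).time_ne h4

/-- A smaller closed set, all of whose boundary components come from those of `X`. -/
def Shrinks (D : Drawing t k) (X : Set (HalfEdge t k)) : Prop :=
  ∃ (D₁ : Drawing t k) (X₁ : Set (HalfEdge t k)), D₁.Closed X₁ ∧ X₁ ⊂ X ∧
    ∀ x ∈ X₁, ∀ y ∈ X₁, D.SameBoundary x y → D₁.SameBoundary x y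

theorem shrinks_cut (h : D.Closed X) {u : HalfEdge t k} (hu : u ∈ X) (hud : ¬ u.IsDown)
    (hut : u.time ≠ 0) (hutip : ¬ D.IsTip u) (huu : D.SameBoundary u (D.mate u))
    {Y : Set (HalfEdge t k)} (hY : Separates D.mate u Y)
    (htips : ∀ x ∈ X, x ∈ Y → D.IsTip x → D.SameBoundary u x → x.vertex = u.vertex) :
    Shrinks D X :=
  ⟨D.cut u, X ∩ Y, h.cut hu hud hut hutip huu hY htips,
    ⟨Set.inter_subset_left, fun h' => hY.mate_notMem (h' (h.mate_mem u hu)).2⟩,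
    fun _ hx _ hy hxy => sameBoundary_cut hY hx.2 hy.2 hxy⟩

/-- The peaks are the two arms of one crossbar, so both halves of its curve are bridges. If either
leads to a crossbar, it can be cut there. If both lead to spots, each spot has a tip on the common
boundary. The spots are then equal or adjacent, but equal spots give parallel edges, and no edge
joins two spots. -/
theorem shrinks_of_vertex_eq (h : D.Closed X) (ht : ∀ i, 3 ≤ t i) {p p' : HalfEdge t k}
    (hpX : p ∈ X) (hp : D.IsPeak p) (hp' : D.IsPeak p') (hpp : D.SameBoundary p p')
    (hne : p ≠ p') (hv : p.vertex = p'.vertex) : Shrinks D X := by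
  have hpX' := h.mem_of_sameBoundary hpX hpp
  have hpd := h.isTip_not_isDown hpX hp.1
  have hpd' := h.isTip_not_isDown hpX' hp'.1
  have hp2 : p' = p.rot.rot := (eq_of_vertex_of_isDown_iff hp.2 hv (by tauto)).resolve_left hne.symm
  have hrd : p.rot.IsDown := (isDown_rot hp.2).2 hpd
  have hrd' : p'.rot.IsDown := (isDown_rot hp'.2).2 hpd'
  -- A tip beyond the bridge `e` on this boundary must be adjacent to the vertex of `p`, and the
  -- bridge is the only way across; so it sits at the far end of `e`.
  have key : ∀ e : HalfEdge t k, e.vertex = p.vertex → e.IsDown → D.SameBoundary p e →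
      D.SameBoundary p (D.mate e) → Shrinks D X ∨ (D.mate e).time = 0 ∧
        ∃ x ∈ X, D.IsTip x ∧ D.SameBoundary p x ∧ x.vertex = (D.mate e).vertex := by
    intro e hev hed hpe hpm
    have heX := h.mem_of_sameBoundary hpX hpe
    have het := h.isDown_not_isTip e heX hed
    have hmt : ¬ D.IsTip (D.mate e) := by rwa [isTip_mate]
    have huu : D.SameBoundary (D.mate e) (D.mate (D.mate e)) := by
      rw [D.mate_mate]; exact hpm.symm.trans hpe
    obtain ⟨Y, hY⟩ := h.bridge _ hmt huu
    have heY : e ∉ Y := by have := hY.mate_notMem; rwa [D.mate_mate] at this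
    have htips : ∀ x ∈ X, x ∈ Y → D.IsTip x → D.SameBoundary (D.mate e) x →
        x.vertex = (D.mate e).vertex := by
      intro x hx hxY hxt hxs
      rcases h.tips x hx p hpX hxt hp.1 (hxs.symm.trans hpm.symm) with h1 | h1
      · exact absurd ((hY.mem_iff_of_vertex (h1.trans hev.symm)).1 hxY) heY
      · exact vertex_eq_of_adj hY hxY heY (hev ▸ h1)
    have hmX := h.mate_mem e heX
    by_cases h0 : (D.mate e).time = 0
    · obtain ⟨x, hx, hxY, hxt, hux⟩ := h.exists_isTip_of_separates ht hmX h0 huu hY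
      exact .inr ⟨h0, x, hx, hxt, hpm.trans hux, htips x hx hxY hxt hux⟩
    · refine .inl (h.shrinks_cut hmX ?_ h0 hmt huu hY htips)
      rw [h.timed.isDown_mate e het, not_not]
      exact hed
  have e1 : D.SameBoundary p p.rot := ⟨1, hp.1.next_eq⟩
  have e2 : D.SameBoundary p p'.rot := hpp.trans ⟨1, hp'.1.next_eq⟩
  have e3 : D.SameBoundary p (D.mate p.rot) :=
    hpp.trans (SameBoundary.symm ⟨1, (next_mate _).trans hp2.symm⟩)
  have e4 : D.SameBoundary p (D.mate p'.rot) := by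
    refine SameBoundary.symm ⟨1, (next_mate _).trans ?_⟩
    rw [hp2, rot_rot_rot_rot hp.2]
  rcases key p.rot (vertex_rot p) hrd e1 e3 with h1 | ⟨h1, x, hx, hxt, hxs, hxv⟩
  · exact h1
  rcases key p'.rot ((vertex_rot p').trans hv.symm) hrd' e2 e4 with h2 | ⟨h2, y, hy, hyt, hys, hyv⟩
  · exact h2
  exfalso
  rcases h.tips x hx y hy hxt hyt (hxs.symm.trans hys) with h3 | h3
  · have := h.sparse.eq_of_vertex p.rot p'.rot
      (h.isDown_not_isTip _ (h.rot_mem _ hpX) hrd) (h.isDown_not_isTip _ (h.rot_mem _ hpX') hrd')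
      (by rw [vertex_rot, vertex_rot, hv]) (by rw [← hxv, ← hyv, h3])
    exact hne (rot_injective this)
  · rw [hxv, hyv] at h3
    exact h.not_adj_of_time h1 h2 h3

/-- The half of the lower curve on the side where `p'` lies is a bridge. A tip beyond it on this
boundary would be adjacent to the vertices of both `p` and `p'`, giving a triangle. So there is
none, which excludes a spot at the far end and makes the cut harmless. -/
theorem shrinks_of_adj (h : D.Closed X) (ht : ∀ i, 3 ≤ t i) {p p' : HalfEdge t k}
    (hpX : p ∈ X) (hp : D.IsPeak p) (hp' : D.IsPeak p') (hpp : D.SameBoundary p p')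
    {x : HalfEdge t k} (hxt : ¬ D.IsTip x) (hxd : ¬ x.IsDown) (hxp : x.vertex = p.vertex)
    (hxp' : (D.mate x).vertex = p'.vertex) : Shrinks D X := by
  have hpX' := h.mem_of_sameBoundary hpX hpp
  have hpd := h.isTip_not_isDown hpX hp.1
  have hpd' := h.isTip_not_isDown hpX' hp'.1
  have hx0 : x.time ≠ 0 := (time_eq_of_vertex hxp).symm ▸ hp.2
  have hpx : p = x.rot.rot := by
    refine (eq_of_vertex_of_isDown_iff hx0 hxp (by tauto)).resolve_left ?_
    rintro rfl; exact hxt hp.1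
  have hxpr : x = p.rot.rot := by rw [hpx, rot_rot_rot_rot hx0]
  have hmd := (h.timed.isDown_mate x hxt).2 hxd
  obtain ⟨e, hev, hed, hpe, hpm⟩ : ∃ e : HalfEdge t k, e.vertex = p.vertex ∧ e.IsDown ∧
      D.SameBoundary p e ∧ D.SameBoundary p (D.mate e) := by
    -- `p'` is the arm on one side or the other of the edge `x`; accordingly the bridge is `p.rot`
    -- or `x.rot`.
    rcases eq_rot_of_vertex_of_isDown_iff hmd.time_ne hxp' (by tauto) with h1 | h1
    · refine ⟨p.rot, vertex_rot p, (isDown_rot hp.2).2 hpd, ⟨1, hp.1.next_eq⟩, ?_⟩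
      have : D.SameBoundary p x := hpp.trans (SameBoundary.symm ⟨1, h1.symm⟩)
      exact this.trans (SameBoundary.symm ⟨1, (next_mate _).trans hxpr.symm⟩)
    · refine ⟨x.rot, (vertex_rot x).trans hxp, (isDown_rot hx0).2 hxd, ?_, ?_⟩
      · have h2 : D.SameBoundary p (D.mate x) :=
          hpp.trans ⟨1, hp'.1.next_eq.trans h1.symm⟩
        exact h2.trans ⟨1, next_mate x⟩
      · exact SameBoundary.symm ⟨1, (next_mate _).trans hpx.symm⟩
  have heX := h.mem_of_sameBoundary hpX hpe
  have het := h.isDown_not_isTip e heX hed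
  have hmt : ¬ D.IsTip (D.mate e) := by rwa [isTip_mate]
  have huu : D.SameBoundary (D.mate e) (D.mate (D.mate e)) := by
    rw [D.mate_mate]; exact hpm.symm.trans hpe
  obtain ⟨Y, hY⟩ := h.bridge _ hmt huu
  have heY : e ∉ Y := by have := hY.mate_notMem; rwa [D.mate_mate] at this
  have hpY : p ∉ Y := fun h' => heY ((hY.mem_iff_of_vertex hev).2 h')
  have hxY : x ∉ Y := fun h' => hpY ((hY.mem_iff_of_vertex hxp).1 h')
  have hpY' : p' ∉ Y := by
    intro h'
    have hmY := (hY.mem_iff_of_vertex hxp').2 h'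
    refine hxY ((hY.mate_mem x ?_ ?_).1 hmY)
    · rintro rfl; exact hxY hY.mem
    · rw [D.mate_mate]; rintro rfl; exact hxd hed
  have hadj : D.Adj p.vertex p'.vertex := ⟨x, hxt, hxp, hxp'⟩
  have hno : ∀ y ∈ X, y ∈ Y → D.IsTip y → ¬ D.SameBoundary (D.mate e) y := by
    intro y hy hyY hyt hys
    have hpy := hpm.trans hys
    rcases h.tips y hy p hpX hyt hp.1 hpy.symm with h1 | h1
    · exact hpY ((hY.mem_iff_of_vertex h1).1 hyY)
    rcases h.tips p' hpX' y hy hp'.1 hyt (hpp.symm.trans hpy) with h2 | h2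
    · exact hpY' ((hY.mem_iff_of_vertex h2).2 hyY)
    exact h.sparse.no_triangle _ _ _ h1 hadj h2
  have hmX := h.mate_mem e heX
  by_cases h0 : (D.mate e).time = 0
  · obtain ⟨y, hy, hyY, hyt, hys⟩ := h.exists_isTip_of_separates ht hmX h0 huu hY
    exact absurd hys (hno y hy hyY hyt)
  · refine h.shrinks_cut hmX ?_ h0 hmt huu hY fun y hy hyY hyt hys =>
      absurd hys (hno y hy hyY hyt)
    rw [h.timed.isDown_mate e het, not_not]
    exact hed

/-- Two open tips of crossbars in the same face lead to a smaller closed set. -/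
theorem shrinks_of_peaks (h : D.Closed X) (ht : ∀ i, 3 ≤ t i) {p p' : HalfEdge t k}
    (hpX : p ∈ X) (hp : D.IsPeak p) (hp' : D.IsPeak p') (hpp : D.SameBoundary p p')
    (hne : p ≠ p') : Shrinks D X := by
  have hpX' := h.mem_of_sameBoundary hpX hpp
  rcases h.tips p hpX p' hpX' hp.1 hp'.1 hpp with hv | ⟨x, hxt, h1, h2⟩
  · exact h.shrinks_of_vertex_eq ht hpX hp hp' hpp hne hv
  · by_cases hxd : x.IsDown
    · have hmd : ¬ (D.mate x).IsDown := by
        rw [h.timed.isDown_mate x hxt, not_not]; exact hxd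
      exact h.shrinks_of_adj ht hpX' hp' hp hpp.symm (x := D.mate x) (by rwa [isTip_mate]) hmd h2
        (by rwa [D.mate_mate])
    · exact h.shrinks_of_adj ht hpX hp hp' hpp hxt hxd h1 h2

end Closed

end Drawing

end BrusselsSprout

/-! ### Six boundary components in a set that cannot shrink -/

namespace BrusselsSprout

variable {n : ℕ} {t : Fin n → ℕ} {k : ℕ}

open HalfEdge

namespace Drawing

variable {D : Drawing t k}

open scoped Classical in
/-- The half-edges at a vertex that are not open tips. -/
noncomputable def edgesAt (D : Drawing t k) (v : Vertex n k) : Finset (HalfEdge t k) :=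
  Finset.univ.filter fun x => x.vertex = v ∧ ¬ D.IsTip x

theorem mem_edgesAt {v : Vertex n k} {x : HalfEdge t k} :
    x ∈ D.edgesAt v ↔ x.vertex = v ∧ ¬ D.IsTip x := by simp [edgesAt]

theorem exists_isTip_of_card_edgesAt_lt (ht : ∀ i, 3 ≤ t i) {x : HalfEdge t k} (hx : x.time = 0)
    (hc : (D.edgesAt x.vertex).card < 3) : ∃ w, w.vertex = x.vertex ∧ D.IsTip w := by
  by_contra! hw
  rcases x with ⟨i, q⟩ | ⟨j, s⟩
  · have h1 : (Finset.univ.map ⟨fun p : Fin (t i) => (Sum.inl ⟨i, p⟩ : HalfEdge t k),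
        fun p q h => by simpa using h⟩) ⊆ D.edgesAt (HalfEdge.vertex (.inl ⟨i, q⟩)) := by
      intro y hy
      obtain ⟨p, -, rfl⟩ := Finset.mem_map.1 hy
      exact mem_edgesAt.2 ⟨rfl, hw _ rfl⟩
    have h2 := Finset.card_le_card h1
    rw [Finset.card_map, Finset.card_univ, Fintype.card_fin] at h2
    have := ht i
    omega
  · simp [time] at hx

namespace Closed

variable {X : Set (HalfEdge t k)}

theorem eq_of_isPeak (h : D.Closed X) (ht : ∀ i, 3 ≤ t i) (hX : ¬ Shrinks D X)
    {p p' : HalfEdge t k} (hpX : p ∈ X) (hp : D.IsPeak p) (hp' : D.IsPeak p')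
    (hpp : D.SameBoundary p p') : p = p' := by
  by_contra hne
  exact hX (h.shrinks_of_peaks ht hpX hp hp' hpp hne)

/-- Both climbs end at the only peak of the boundary. By injectivity of `next` one is a tail of the
other, and since times stay positive after the start, a tail beginning at a spot is the whole climb.
-/
theorem eq_of_sameBoundary (h : D.Closed X) (ht : ∀ i, 3 ≤ t i) (hX : ¬ Shrinks D X)
    {z z' : HalfEdge t k} (hzX : z ∈ X) (hz : z.time = 0) (hz' : z'.time = 0)
    (hzt : ¬ D.IsTip z) (hzt' : ¬ D.IsTip z') (hzz : D.SameBoundary z z') : z = z' := by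
  obtain ⟨m, hm, hj⟩ := h.exists_peak (not_isDown_of_time hz) hzt
  obtain ⟨m', hm', hj'⟩ := h.exists_peak (not_isDown_of_time hz') hzt'
  have hs : D.SameBoundary z (D.next^[m + 1] z) := ⟨_, rfl⟩
  have hs' : D.SameBoundary z' (D.next^[m' + 1] z') := ⟨_, rfl⟩
  have heq := h.eq_of_isPeak ht hX (h.mem_of_sameBoundary hzX hs) hm hm'
    (hs.symm.trans (hzz.trans hs'))
  have key : ∀ {m m' : ℕ} {z z' : HalfEdge t k}, m ≤ m' → z.time = 0 →
      (∀ j ≤ m', z'.time < (D.next^[j + 1] z').time) →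
      D.next^[m + 1] z = D.next^[m' + 1] z' → z = z' := by
    intro m m' z z' hmm hz hj heq
    obtain ⟨l, rfl⟩ := Nat.exists_eq_add_of_le hmm
    rw [show m + l + 1 = (m + 1) + l by omega, Function.iterate_add_apply D.next (m + 1) l] at heq
    have h1 := D.next_injective.iterate _ heq
    rcases l with _ | l
    · exact h1
    · have := hj l (by omega)
      rw [← h1] at this
      omega
  rcases le_total m m' with hmm | hmm
  · exact key hmm hz hj' heq
  · exact (key hmm hz' hj heq.symm).symm

/-- The boundary through `w` turns about the spot to an edge and climbs to a peak. This peak is not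
at the spot, so the condition on tips makes its vertex a neighbour of the spot. -/
theorem exists_peak_of_isTip (h : D.Closed X) {w : HalfEdge t k} (hwX : w ∈ X)
    (hw : w.time = 0) (hwt : D.IsTip w) :
    ∃ x p, x.vertex = w.vertex ∧ ¬ D.IsTip x ∧ p ∈ X ∧ D.IsPeak p ∧
      p.vertex = (D.mate x).vertex ∧ D.SameBoundary w p := by
  obtain ⟨z, hz, hzt, hwz⟩ := h.exists_spot_edge_sameBoundary hw
  have hz0 := (time_eq_of_vertex hz).trans hw
  obtain ⟨m, hm, -⟩ := h.exists_peak (not_isDown_of_time hz0) hzt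
  have hs : D.SameBoundary w (D.next^[m + 1] z) := hwz.trans ⟨_, rfl⟩
  have hpX := h.mem_of_sameBoundary hwX hs
  rcases h.tips w hwX _ hpX hwt hm.1 hs with h1 | ⟨x, hxt, h1, h2⟩
  · exact absurd ((time_eq_of_vertex h1).symm.trans hw) hm.2
  · exact ⟨x, _, h1, hxt, hpX, hm, h2.symm, hs⟩

/-- With at most one edge the spot has a tip, hence a peak at the far end of its only edge `z`.
Either side of `z` on which this peak lies contradicts uniqueness on the boundary. -/
theorem two_le_card_edgesAt (h : D.Closed X) (ht : ∀ i, 3 ≤ t i) (hX : ¬ Shrinks D X)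
    {s : HalfEdge t k} (hsX : s ∈ X) (hs : s.time = 0) : 2 ≤ (D.edgesAt s.vertex).card := by
  by_contra! hc
  obtain ⟨w, hws, hwt⟩ := exists_isTip_of_card_edgesAt_lt ht hs (hc.trans (by omega))
  have hw0 := (time_eq_of_vertex hws).trans hs
  have hwX := h.mem_of_vertex hsX hws.symm
  obtain ⟨z, p, hzw, hzt, hpX, hp, hpz, hwp⟩ := h.exists_peak_of_isTip hwX hw0 hwt
  have huniq : ∀ x, x.vertex = s.vertex → ¬ D.IsTip x → x = z := fun x hx hxt =>
    Finset.card_le_one.1 (by omega) x (mem_edgesAt.2 ⟨hx, hxt⟩) z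
      (mem_edgesAt.2 ⟨hzw.trans hws, hzt⟩)
  have hz0 := (time_eq_of_vertex hzw).trans hw0
  have hzp : D.SameBoundary z p := by
    obtain ⟨z', hz', hzt', hwz'⟩ := h.exists_spot_edge_sameBoundary hw0
    obtain rfl := huniq z' (hz'.trans hws) hzt'
    exact hwz'.symm.trans hwp
  have hzX := h.mem_of_vertex hwX hzw.symm
  have hpd := h.isTip_not_isDown hpX hp.1
  have hq := (h.timed.isDown_mate z hzt).2 (not_isDown_of_time hz0)
  rcases eq_rot_of_vertex_of_isDown_iff hp.2 hpz (by tauto) with h1 | h1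
  -- The walk along `z` continues with the opposite arm, which is a second peak or climbs to one
  -- younger than `p`.
  · have h2 : D.SameBoundary p p.rot.rot :=
      hzp.symm.trans ⟨1, by rw [Function.iterate_one, Drawing.next, h1]⟩
    have hr0 : p.rot.rot.time ≠ 0 := by simpa using hp.2
    by_cases hrt : D.IsTip p.rot.rot
    · exact rot_rot_ne hp.2 (h.eq_of_isPeak ht hX hpX hp ⟨hrt, hr0⟩ h2).symm
    · have hrd : ¬ p.rot.rot.IsDown := by
        rw [isDown_rot (by simpa using hp.2), isDown_rot hp.2, not_not]; exact hpd
      obtain ⟨m, hm, hj⟩ := h.exists_peak hrd hrt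
      have h3 := h.eq_of_isPeak ht hX hpX hp hm (h2.trans ⟨_, rfl⟩)
      have h4 := hj m le_rfl
      rw [← h3] at h4
      simp at h4
  -- After `p` the walk descends the other half of the curve to a spot. The edge by which it leaves
  -- must be `z`, so it came down along `D.mate z`, which is neither `p.rot` nor older than it.
  · have hprd : p.rot.IsDown := (isDown_rot hp.2).2 hpd
    have hppr : D.SameBoundary p p.rot := ⟨1, hp.1.next_eq⟩
    obtain ⟨y, hyX, hyd, hy0, hpy, hyt⟩ := h.exists_spot (h.rot_mem p hpX) hprd
    have hytip := h.isDown_not_isTip y hyX hyd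
    obtain ⟨z₁, hz₁, hzt₁, hyz₁⟩ := h.exists_spot_edge_sameBoundary (x := D.next y)
      (by rw [Drawing.next, time_rot, hy0])
    have hz₁' : z₁.vertex = (D.mate y).vertex := by rw [hz₁, Drawing.next, vertex_rot]
    have hzz : z = z₁ := h.eq_of_sameBoundary ht hX hzX hz0 ((time_eq_of_vertex hz₁').trans hy0)
      hzt hzt₁ (hzp.trans (hppr.trans (hpy.trans ((SameBoundary.next D y).trans hyz₁))))
    have hmy : D.mate y = z :=
      huniq _ (by rw [← hz₁', ← hzz, hzw, hws]) (by rwa [isTip_mate])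
    have hyq : y = D.mate z := by rw [← hmy, D.mate_mate]
    rcases hyt with h2 | h2
    · rw [hyq] at h2
      exact rot_rot_ne hq.time_ne (by rw [← h1, ← h2])
    · rw [hyq, time_rot, time_eq_of_vertex hpz] at h2
      omega

theorem exists_min_time {P : HalfEdge t k → Prop} (hP : ∃ x, P x) :
    ∃ x, P x ∧ ∀ y, P y → x.time ≤ y.time :=
  Set.exists_min_image {x | P x} time (Set.toFinite _) hP

theorem exists_isDown (x : HalfEdge t k) (hx : x.time ≠ 0) :
    ∃ e : HalfEdge t k, e.IsDown ∧ e.vertex = x.vertex := by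
  by_cases hxd : x.IsDown
  · exact ⟨x, hxd, rfl⟩
  · exact ⟨x.rot, (isDown_rot hx).2 hxd, vertex_rot x⟩

theorem isDown_rot_rot {e : HalfEdge t k} (he : e.IsDown) : e.rot.rot.IsDown := by
  rw [isDown_rot (by simpa using he.time_ne), isDown_rot he.time_ne, not_not]; exact he

theorem vertex_mate_ne (h : D.Closed X) {e : HalfEdge t k} (he : e ∈ X) (hed : e.IsDown) :
    (D.mate e).vertex ≠ (D.mate e.rot.rot).vertex := by
  intro h'
  refine rot_rot_ne hed.time_ne (h.sparse.eq_of_vertex e e.rot.rot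
    (h.isDown_not_isTip e he hed)
    (h.isDown_not_isTip _ (h.rot_mem _ (h.rot_mem _ he)) (isDown_rot_rot hed)) ?_ h').symm
  simp

/-- The boundary walk through an open tip of a crossbar that joins two spots passes both spots. -/
theorem not_isPeak_of_mates (h : D.Closed X) (ht : ∀ i, 3 ≤ t i) (hX : ¬ Shrinks D X)
    {p e : HalfEdge t k} (hpX : p ∈ X) (hev : e.vertex = p.vertex) (hed : e.IsDown)
    (h1 : (D.mate e).time = 0) (h2 : (D.mate e.rot.rot).time = 0) : ¬ D.IsPeak p := by
  intro hp
  have hpd := h.isTip_not_isDown hpX hp.1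
  have hprd : p.rot.IsDown := (isDown_rot hp.2).2 hpd
  obtain ⟨h3, h4⟩ : (D.mate p.rot).time = 0 ∧ (D.mate p.rot.rot.rot).time = 0 := by
    rcases eq_of_vertex_of_isDown_iff hed.time_ne (hev.trans (vertex_rot p).symm)
      (iff_of_true hed hprd) with h' | h'
    · rw [h']; exact ⟨h1, h2⟩
    · rw [h', rot_rot_rot_rot hed.time_ne]; exact ⟨h2, h1⟩
  have hprX := h.rot_mem p hpX
  have hpr3X := h.rot_mem _ (h.rot_mem _ hprX)
  have hpr3d := isDown_rot_rot hprd
  obtain ⟨z, hz, hzt, hyz⟩ := h.exists_spot_edge_sameBoundary (x := D.next p.rot)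
    (by rw [Drawing.next, time_rot, h3])
  have hz' : z.vertex = (D.mate p.rot).vertex := by rw [hz, Drawing.next, vertex_rot]
  have h5 : D.SameBoundary (D.mate p.rot.rot.rot) p :=
    ⟨1, (next_mate _).trans (rot_rot_rot_rot hp.2)⟩
  have h6 : D.SameBoundary p z :=
    .trans ⟨1, hp.1.next_eq⟩ ((SameBoundary.next D p.rot).trans hyz)
  have h7 := h.eq_of_sameBoundary ht hX (h.mate_mem _ hpr3X) h4
    ((time_eq_of_vertex hz').trans h3)
    (by rw [isTip_mate]; exact h.isDown_not_isTip _ hpr3X hpr3d) hzt (h5.trans h6)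
  exact h.vertex_mate_ne hprX hprd (by rw [h7, hz'])

/-- Otherwise the spot has a tip and so a neighbour with a peak `p`, which is not the crossbar of
`e`. The oldest other crossbar also joins the two spots, so with at most two edges at the spot it
must be the vertex of `p`. But `not_isPeak_of_mates` excludes a peak there. -/
theorem three_le_card_edgesAt (h : D.Closed X) (ht : ∀ i, 3 ≤ t i) (hX : ¬ Shrinks D X)
    {e : HalfEdge t k} (heX : e ∈ X) (hed : e.IsDown) (h1 : (D.mate e).time = 0)
    (h2 : (D.mate e.rot.rot).time = 0)
    (hspots : ∀ s ∈ X, s.time = 0 → s.vertex = (D.mate e).vertex ∨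
      s.vertex = (D.mate e.rot.rot).vertex) : 3 ≤ (D.edgesAt (D.mate e).vertex).card := by
  by_contra! hc
  have het := h.isDown_not_isTip e heX hed
  have herX := h.rot_mem _ (h.rot_mem _ heX)
  have hert := h.isDown_not_isTip _ herX (isDown_rot_rot hed)
  have hmX := h.mate_mem e heX
  obtain ⟨w, hw, hwt⟩ := exists_isTip_of_card_edgesAt_lt ht h1 hc
  obtain ⟨x, p, hxw, hxt, hpX, hp, hpx, -⟩ := h.exists_peak_of_isTip
    (h.mem_of_vertex hmX hw.symm) ((time_eq_of_vertex hw).trans h1) hwt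
  have hxv := hxw.trans hw
  have hxX := h.mem_of_vertex hmX hxv.symm
  by_cases hxe : x = D.mate e
  · exact h.not_isPeak_of_mates ht hX hpX (by rw [hpx, hxe, D.mate_mate]) hed h1 h2 hp
  have hadj : ∀ s ∈ X, s.time = 0 → D.Adj e.vertex s.vertex := by
    intro s hs hs0
    rcases hspots s hs hs0 with h' | h'
    · exact ⟨e, het, rfl, h'.symm⟩
    · exact ⟨e.rot.rot, hert, by simp, h'.symm⟩
  obtain ⟨y, ⟨hyX, hy0, hye⟩, hmin⟩ := exists_min_time
    (P := fun y : HalfEdge t k => y ∈ X ∧ y.time ≠ 0 ∧ y.vertex ≠ e.vertex)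
    ⟨p, hpX, hp.2, fun h' => hxe (h.sparse.eq_of_vertex _ _ hxt (by rwa [isTip_mate]) hxv
      (by rw [D.mate_mate, ← hpx, h']))⟩
  have hcross : ∀ f ∈ X, f.IsDown → f.vertex = y.vertex → (D.mate f).time ≠ 0 →
      (D.mate f).vertex = e.vertex := by
    intro f hfX hfd hfy hf0
    by_contra h'
    have h3 := hmin _ ⟨h.mate_mem f hfX, hf0, h'⟩
    have h4 := h.timed.time_mate_lt f hfd (h.isDown_not_isTip f hfX hfd)
    rw [time_eq_of_vertex hfy] at h4
    omega
  -- If one half ended at the crossbar of `e`, the other would end at a spot, and both spots are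
  -- adjacent to that crossbar: a triangle.
  have hold : ∀ f : HalfEdge t k, f.IsDown → f.vertex = y.vertex → (D.mate f).time = 0 := by
    intro f hfd hfy
    by_contra hf0
    have hfX := h.mem_of_vertex hyX hfy.symm
    have hfrX := h.rot_mem _ (h.rot_mem _ hfX)
    have h3 := hcross f hfX hfd hfy hf0
    have h4 : (D.mate f.rot.rot).time = 0 := by
      by_contra h4
      have h5 := hcross f.rot.rot hfrX (isDown_rot_rot hfd) (by simpa using hfy) h4
      exact h.vertex_mate_ne hfX hfd (h3.trans h5.symm)
    refine h.sparse.no_triangle f.vertex e.vertex (D.mate f.rot.rot).vertex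
      ⟨f, h.isDown_not_isTip f hfX hfd, rfl, h3⟩ (hadj _ (h.mate_mem _ hfrX) h4)
      (Adj.symm ⟨f.rot.rot, h.isDown_not_isTip _ hfrX (isDown_rot_rot hfd), by simp, rfl⟩)
  obtain ⟨f, hfd, hfy⟩ := exists_isDown y hy0
  have hfry : f.rot.rot.vertex = y.vertex := by simpa using hfy
  have hfX := h.mem_of_vertex hyX hfy.symm
  obtain ⟨g, hgd, hgy, hgv⟩ : ∃ g : HalfEdge t k, g.IsDown ∧ g.vertex = y.vertex ∧
      (D.mate g).vertex = (D.mate e).vertex := by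
    have hne := h.vertex_mate_ne hfX hfd
    rcases hspots _ (h.mate_mem f hfX) (hold f hfd hfy) with h3 | h3
    · exact ⟨f, hfd, hfy, h3⟩
    · rcases hspots _ (h.mate_mem _ (h.rot_mem _ (h.rot_mem _ hfX)))
        (hold _ (isDown_rot_rot hfd) hfry) with h4 | h4
      · exact ⟨f.rot.rot, isDown_rot_rot hfd, hfry, h4⟩
      · exact absurd (h3.trans h4.symm) hne
  have hgX := h.mem_of_vertex hyX hgy.symm
  have hgt := h.isDown_not_isTip g hgX hgd
  have hge : D.mate g ≠ D.mate e := by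
    intro h'
    apply hye
    rw [← hgy, ← D.mate_mate g, h', D.mate_mate]
  have hxg : x = D.mate g := by
    by_contra hxg
    have h3 : ({x, D.mate e, D.mate g} : Set (HalfEdge t k)) ⊆ D.edgesAt (D.mate e).vertex := by
      rintro z (rfl | rfl | rfl)
      · exact mem_edgesAt.2 ⟨hxv, hxt⟩
      · exact mem_edgesAt.2 ⟨rfl, by rwa [isTip_mate]⟩
      · exact mem_edgesAt.2 ⟨hgv, by rwa [isTip_mate]⟩
    have h4 := Set.ncard_le_ncard h3 (Set.toFinite _)
    rw [Set.ncard_coe_finset, Set.ncard_eq_three.2 ⟨x, D.mate e, D.mate g, hxe, hxg, hge.symm, rfl⟩]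
      at h4
    omega
  refine h.not_isPeak_of_mates ht hX hpX (e := g) ?_ hgd (hold g hgd hgy)
    (hold _ (isDown_rot_rot hgd) (by simpa using hgy)) hp
  rw [hpx, hxg, D.mate_mate]

/-- A closed set that cannot be made smaller touches at least six boundary components. -/
theorem exists_six_of_not_shrinks (h : D.Closed X) (ht : ∀ i, 3 ≤ t i) (hX : ¬ Shrinks D X) :
    ∃ A : Finset (HalfEdge t k), 6 ≤ A.card ∧ (∀ x ∈ A, x ∈ X) ∧
      ∀ x ∈ A, ∀ y ∈ A, D.SameBoundary x y → x = y := by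
  classical
  have hsuff : ∀ A : Finset (HalfEdge t k), 6 ≤ A.card →
      (∀ x ∈ A, x ∈ X ∧ x.time = 0 ∧ ¬ D.IsTip x) → ∃ A : Finset (HalfEdge t k), 6 ≤ A.card ∧
        (∀ x ∈ A, x ∈ X) ∧ ∀ x ∈ A, ∀ y ∈ A, D.SameBoundary x y → x = y := fun A hA hA' =>
    ⟨A, hA, fun x hx => (hA' x hx).1, fun x hx y hy => h.eq_of_sameBoundary ht hX
      (hA' x hx).1 (hA' x hx).2.1 (hA' y hy).2.1 (hA' x hx).2.2 (hA' y hy).2.2⟩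
  have hedges : ∀ s ∈ X, s.time = 0 → ∀ x ∈ D.edgesAt s.vertex,
      x ∈ X ∧ x.time = 0 ∧ ¬ D.IsTip x := by
    intro s hs hs0 x hx
    rw [mem_edgesAt] at hx
    exact ⟨h.mem_of_vertex hs hx.1.symm, (time_eq_of_vertex hx.1).trans hs0, hx.2⟩
  have hdisj : ∀ v w : Vertex n k, v ≠ w → Disjoint (D.edgesAt v) (D.edgesAt w) := by
    intro v w hvw
    refine Finset.disjoint_left.2 fun x hx hx' => hvw ?_
    rw [← (mem_edgesAt.1 hx).1, (mem_edgesAt.1 hx').1]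
  -- The oldest crossbar in `X` can only join spots, and these are distinct.
  obtain ⟨y, ⟨hyX, hy0⟩, hmin⟩ := exists_min_time
    (P := fun y : HalfEdge t k => y ∈ X ∧ y.time ≠ 0) h.exists_crossbar
  obtain ⟨e, hed, hey⟩ := exists_isDown y hy0
  have heX := h.mem_of_vertex hyX hey.symm
  have hfirst : ∀ f : HalfEdge t k, f.IsDown → f.vertex = y.vertex → (D.mate f).time = 0 := by
    intro f hfd hfy
    by_contra hf0
    have hfX := h.mem_of_vertex hyX hfy.symm
    have h1 := hmin _ ⟨h.mate_mem f hfX, hf0⟩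
    have h2 := h.timed.time_mate_lt f hfd (h.isDown_not_isTip f hfX hfd)
    rw [time_eq_of_vertex hfy] at h2
    omega
  have hey' : e.rot.rot.vertex = y.vertex := by simpa using hey
  have hed' := isDown_rot_rot hed
  have heX' := h.rot_mem _ (h.rot_mem _ heX)
  have h1 := hfirst e hed hey
  have h2 := hfirst _ hed' hey'
  have hm1 := h.mate_mem e heX
  have hm2 := h.mate_mem _ heX'
  have hne := h.vertex_mate_ne heX hed
  by_cases hspots : ∀ s ∈ X, s.time = 0 → s.vertex = (D.mate e).vertex ∨
      s.vertex = (D.mate e.rot.rot).vertex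
  · have h3 := h.three_le_card_edgesAt ht hX heX hed h1 h2 hspots
    have h4 := h.three_le_card_edgesAt ht hX heX' hed' h2
      (by rwa [rot_rot_rot_rot hed.time_ne]) (by
        intro s hs hs0
        rw [rot_rot_rot_rot hed.time_ne]
        exact (hspots s hs hs0).symm)
    refine hsuff (D.edgesAt (D.mate e).vertex ∪ D.edgesAt (D.mate e.rot.rot).vertex) ?_ ?_
    · rw [Finset.card_union_of_disjoint (hdisj _ _ hne)]; omega
    · intro x hx
      rcases Finset.mem_union.1 hx with hx | hx
      exacts [hedges _ hm1 h1 x hx, hedges _ hm2 h2 x hx]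
  · push Not at hspots
    obtain ⟨s, hs, hs0, hs1, hs2⟩ := hspots
    have h3 := h.two_le_card_edgesAt ht hX hm1 h1
    have h4 := h.two_le_card_edgesAt ht hX hm2 h2
    have h5 := h.two_le_card_edgesAt ht hX hs hs0
    refine hsuff (D.edgesAt (D.mate e).vertex ∪ D.edgesAt (D.mate e.rot.rot).vertex ∪
      D.edgesAt s.vertex) ?_ ?_
    · rw [Finset.card_union_of_disjoint (Finset.disjoint_union_left.2
        ⟨hdisj _ _ hs1.symm, hdisj _ _ hs2.symm⟩), Finset.card_union_of_disjoint (hdisj _ _ hne)]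
      omega
    · intro x hx
      rcases Finset.mem_union.1 hx with hx | hx
      · rcases Finset.mem_union.1 hx with hx | hx
        exacts [hedges _ hm1 h1 x hx, hedges _ hm2 h2 x hx]
      · exact hedges _ hs hs0 x hx

/-- A closed set touches at least six boundary components. -/
theorem exists_six (h : D.Closed X) (ht : ∀ i, 3 ≤ t i) :
    ∃ A : Finset (HalfEdge t k), 6 ≤ A.card ∧ (∀ x ∈ A, x ∈ X) ∧
      ∀ x ∈ A, ∀ y ∈ A, D.SameBoundary x y → x = y := by
  obtain ⟨N, hN⟩ : ∃ N, X.ncard ≤ N := ⟨_, le_rfl⟩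
  induction N generalizing D X with
  | zero =>
    obtain ⟨x, hx, -⟩ := h.exists_crossbar
    have := (Set.ncard_pos (Set.toFinite X)).2 ⟨x, hx⟩
    omega
  | succ N ih =>
    by_cases hX : Shrinks D X
    · obtain ⟨D₁, X₁, h₁, hlt, hs⟩ := hX
      obtain ⟨A, hA, hAX, hAs⟩ := ih h₁ (by
        have := Set.ncard_lt_ncard hlt (Set.toFinite _); omega)
      exact ⟨A, hA, fun x hx => hlt.1 (hAX x hx), fun x hx y hy hxy =>
        hAs x hx y hy (hs x (hAX x hx) y (hAX y hy) hxy)⟩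
    · exact h.exists_six_of_not_shrinks ht hX

end Closed

end Drawing

end BrusselsSprout

/-! ### Invariants of a play and the final position -/

namespace BrusselsSprout

variable {n : ℕ} {t : Fin n → ℕ} {k : ℕ}

open HalfEdge Module

namespace Drawing

variable {D : Drawing t k}

/-- What is preserved along a play. -/
structure Position (D : Drawing t k) : Prop where
  tally : ∃ S M, D.Tally S M
  bridge : D.BridgeProperty
  timed : D.Timed
  isDown_not_isTip : ∀ d, d.IsDown → ¬ D.IsTip d
  sparse : D.Sparse

theorem Position.start (hn : 0 < n) (ht : ∀ i, 0 < t i) : (Drawing.start t).Position where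
  tally := ⟨0, 0, .start hn ht⟩
  bridge _ hd := absurd rfl hd
  timed := ⟨fun _ hd => absurd rfl hd, fun _ _ hd => absurd rfl hd⟩
  isDown_not_isTip := by
    rintro (d | ⟨j, s⟩) hd
    · exact hd.elim
    · exact j.elim0
  sparse := by
    have h : ∀ x y, ¬ (Drawing.start t).Adj x y := fun x y ⟨d, hd, _⟩ => hd rfl
    exact ⟨fun x => h x x, fun d _ hd => absurd rfl hd, fun x y _ hxy => absurd hxy (h x y)⟩

theorem Position.move (hD : D.Position) {a b : HalfEdge t k} {D' : Drawing t (k + 1)}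
    (h : D.IsMove a b D') (hs : D'.Sparse) : D'.Position := by
  obtain ⟨S, M, hT⟩ := hD.tally
  obtain ⟨h1, h2⟩ := h.timed hD.timed hD.isDown_not_isTip
  refine ⟨?_, h.bridgeProperty hD.bridge (hT.exists_compFun_ne h.isTip_left h.isTip_right h.region),
    h1, h2, hs⟩
  by_cases hab : D.SameBoundary a b
  · exact ⟨_, _, hT.move_of_sameBoundary h hab⟩
  · exact ⟨_, _, hT.move_of_not_sameBoundary h hab⟩

theorem Position.of_reachable (hn : 0 < n) (ht : ∀ i, 0 < t i)
    (h : Reachable GirthAtLeastFour t k D) : D.Position := by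
  induction h with
  | start => exact .start hn ht
  | move _ hm hF ih => exact ih.move hm (sparse_iff.1 hF)

theorem Position.add_four_le (hD : D.Position) (hn : 2 ≤ n) (ht : ∀ i, 3 ≤ t i)
    (hend : Ended GirthAtLeastFour D) : n + 4 ≤ k := by
  obtain ⟨S, M, hT⟩ := hD.tally
  have htips : ∀ x y, D.IsTip x → D.IsTip y → D.region x y →
      x.vertex = y.vertex ∨ D.Adj x.vertex y.vertex := by
    intro x y hx hy hxy
    by_contra! hne
    obtain ⟨D', h⟩ := exists_isMove hx hy (by rintro rfl; exact hne.1 rfl) hxy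
    exact hend x y D' h (sparse_iff.2 (h.sparse hD.sparse hne.1 hne.2))
  obtain ⟨T, hTt, hTc, hTs⟩ := hT.boundaries
  -- Tips on two boundaries of one region would lie in different components, yet their vertices are
  -- equal or adjacent.
  have hregion : ∀ x y, D.region x y → D.SameBoundary x y := by
    intro x y hxy
    obtain ⟨p, hp, hxp⟩ := hTs x
    obtain ⟨q, hq, hyq⟩ := hTs y
    have hpq : D.region p q :=
      D.region.trans (D.region.symm hxp.region) (D.region.trans hxy hyq.region)
    by_cases h : D.SameBoundary p q
    · exact hxp.trans (h.trans hyq.symm)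
    · obtain ⟨g, hg, hne⟩ := hT.exists_compFun_ne (hTt p hp) (hTt q hq) hpq h
      rcases htips p q (hTt p hp) (hTt q hq) hpq with h' | h'
      · exact absurd (compFun_vertex hg h') hne
      · exact absurd (compFun_adj hg h') hne
  -- With one boundary per region, a function constant on components is constant on regions; by
  -- `joined` the drawing is connected.
  have hconst : ∀ g ∈ D.compFun, ∀ x y, g x = g y := fun g hg =>
    hT.joined g (fun d e hde => compFun_sameBoundary hg (hregion d e hde)) hg
  have ht0 : ∀ i, 0 < t i := fun i => by have := ht i; omega
  have hM : n ≤ 1 + M := by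
    let x₀ : HalfEdge t k := .inl ⟨⟨0, by omega⟩, ⟨0, ht0 _⟩⟩
    let L : D.compFun →ₗ[ℚ] ℚ :=
      { toFun := fun g => g.1 x₀
        map_add' := by intro p q; rfl
        map_smul' := by intro c p; rfl }
    have h1 := LinearMap.finrank_le_finrank_of_injective (f := L) fun g g' h =>
      Subtype.ext (funext fun x => by rw [hconst g.1 g.2 x x₀, hconst g'.1 g'.2 x x₀]; exact h)
    rw [finrank_self] at h1
    have h2 := hT.comps
    omega
  have hspot : ∀ x : HalfEdge t k, x.time = 0 → ∃ y, y.vertex = x.vertex ∧ ¬ D.IsTip y := by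
    classical
    intro x hx
    by_contra! hall
    let g : HalfEdge t k → ℚ := fun y => if y.vertex = x.vertex then 1 else 0
    have hg : g ∈ D.compFun := by
      intro d
      refine ⟨by simp [g], ?_⟩
      by_cases h1 : d.vertex = x.vertex
      · rw [hall d h1]
      · have h2 : (D.mate d).vertex ≠ x.vertex := by
          intro h2
          exact h1 ((congrArg HalfEdge.vertex (isTip_mate.1 (hall _ h2))).symm.trans h2)
        simp [g, h1, h2]
    obtain ⟨y, hy⟩ : ∃ y : HalfEdge t k, y.vertex ≠ x.vertex := by
      by_contra! hy
      have h1 := (hy (.inl ⟨⟨0, by omega⟩, ⟨0, ht0 _⟩⟩)).trans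
        (hy (.inl ⟨⟨1, by omega⟩, ⟨0, ht0 _⟩⟩)).symm
      simp [HalfEdge.vertex] at h1
    have := hconst g hg x y
    simp [g, hy] at this
  have hclosed : D.Closed Set.univ :=
    { sparse := hD.sparse
      timed := hD.timed
      bridge := hD.bridge
      rot_mem := fun _ _ => trivial
      mate_mem := fun _ _ => trivial
      isDown_not_isTip := fun x _ => hD.isDown_not_isTip x
      exists_spot_edge := hspot
      tips := fun x _ y _ hx hy hxy => htips x y hx hy hxy.region
      exists_crossbar := by
        obtain ⟨y, hy, hyt⟩ := hspot (.inl ⟨⟨0, by omega⟩, ⟨0, ht0 _⟩⟩) rfl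
        refine ⟨D.mate y, trivial, ?_⟩
        exact ((hD.timed.isDown_mate y hyt).2 fun h => h.time_ne (time_eq_of_vertex hy)).time_ne }
  obtain ⟨A, hA, -, hAs⟩ := hclosed.exists_six ht
  have hAT : A.card ≤ T.card := by
    choose f hf hf' using hTs
    refine Finset.card_le_card_of_injOn f (fun x _ => hf x) fun x hx y hy hxy => ?_
    refine hAs x hx y hy ((hf' x).trans ?_)
    rw [hxy]
    exact (hf' y).symm
  -- `6 + M ≤ T.card + M ≤ n + S` and `n ≤ 1 + M` give `k = S + M ≥ 6 + 2 * M - n ≥ n + 4`.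
  have := hT.moves
  omega

end Drawing

end BrusselsSprout

theorem mainTheorem10 (n : ℕ) (hn : 2 ≤ n) (t : Fin n → ℕ) (ht : ∀ i, 3 ≤ t i) :
    (∀ (k : ℕ) (D : BrusselsSprout.Drawing t k),
      BrusselsSprout.Reachable BrusselsSprout.GirthAtLeastFour t k D →
        k ≤ (n - 2) + ∑ i, t i) ∧
    (∀ (k : ℕ) (D : BrusselsSprout.Drawing t k),
      BrusselsSprout.Reachable BrusselsSprout.GirthAtLeastFour t k D →
        BrusselsSprout.Ended BrusselsSprout.GirthAtLeastFour D →
          n + 4 ≤ k ∧ k ≤ (n - 2) + ∑ i, t i) := by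
  have hpos : ∀ (k : ℕ) (D : BrusselsSprout.Drawing t k),
      BrusselsSprout.Reachable BrusselsSprout.GirthAtLeastFour t k D → D.Position :=
    fun k D h => .of_reachable (by omega) (fun i => by have := ht i; omega) h
  have hle : ∀ (k : ℕ) (D : BrusselsSprout.Drawing t k),
      BrusselsSprout.Reachable BrusselsSprout.GirthAtLeastFour t k D →
        k ≤ (n - 2) + ∑ i, t i := fun k D h => by
    obtain ⟨S, M, hT⟩ := (hpos k D h).tally
    exact hT.le hn
  exact ⟨hle, fun k D h hend => ⟨(hpos k D h).add_four_le hn ht hend, hle k D h⟩⟩
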